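/- Let $d\ge 0$, let $H:\mathbb{R}^{2d}\to\mathbb{R}$ be smooth, and let $G$ be a finite subgroup of $GL(d,\mathbb{R})$, acting on $\mathbb{R}^{2d}=\mathbb{R}^d\times\mathbb{R}^d$ by $M(g)(x,\xi)=(gx,{}^tg^{-1}\xi)$, such that $H(M(g)z)=H(z)$ for all $g\in G$, $z\in\mathbb{R}^{2d}$. Let $J=\begin{pmatrix}0&I_d\\-I_d&0\end{pmatrix}$, let $\Phi_t(z)=z_t$ be the flow of $\dot z=J\nabla H(z)$, with maximal domain $\mathcal{D}\subset\mathbb{R}\times\mathbb{R}^{2d}$, and let $F_z(t)=\partial_z\Phi_t(z)=\begin{pmatrix}A&B\\C&D\end{pmatrix}$ (blocks of size $d\times d$). Fix $g\in G$ and $E\in\mathbb{R}$, and put $\Sigma_E=\{H=E\}$. Set $M_0=(C+iD)(A+iB)^{-1}$, define $W_t$ by $\frac12(I+W_t)=(I-i\,{}^tg^{-1}M_0g^{-1})^{-1}$, and let $\widehat{W_t}=\begin{pmatrix}W_t&-iW_t\\-iW_t&-W_t\end{pmatrix}$. The phase $\varphi_{E,g}=\varphi_1+i\varphi_2:\mathcal{D}\to\mathbb{C}$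 is given by $$\varphi_1(t,z)=(E-H(z))t+\tfrac12\langle M(g)^{-1}z,Jz\rangle-\tfrac12\int_0^t\langle z_s-M(g)^{-1}z,\,J\dot z_s\rangle\,ds,$$ $$\varphi_2(t,z)=\tfrac14\langle (I-\widehat{W_t})(M(g)z_t-z),\,M(g)z_t-z\rangle,$$ where $\langle\cdot,\cdot\rangle$ is the bilinear pairing $\langle u,v\rangle=\sum_j u_jv_j$. Its critical set is $$\mathcal{C}_{E,g}=\{a\in\mathcal{D}:\ \Im\varphi_{E,g}(a)=0,\ \nabla\varphi_{E,g}(a)=0\}.$$ The domain $\mathcal{D}$ is open, $\Phi$ and $\varphi_{E,g}$ are smooth on $\mathcal{D}$, and $\mathcal{D}=\mathbb{R}\times\mathbb{R}^{2d}$ if $|\nabla H|\le C(1+|H|)$ on $\mathbb{R}^{2d}$ for some constant $C$. Moreover: (i) $\mathcal{C}_{E,g}=\{(t,z)\in\mathcal{D}:\ z\in\Sigma_E,\ M(g)\Phi_t(z)=z\}$. (ii) If $(t,z)\in\mathcal{C}_{E,g}$, the real kernel $\ker_{\mathbb{R}}\mathrm{Hess}\,\varphi_{E,g}(t,z)$ of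 the Hessian, that is, the set of the real vectors $v\in\mathbb{R}\times\mathbb{R}^{2d}$ with $\mathrm{Hess}\,\varphi_{E,g}(t,z)\,v=0$, is $$\{(\tau,\alpha)\in\mathbb{R}\times\mathbb{R}^{2d}:\ \alpha\perp\nabla H(z),\ \tau J\nabla H(z)+(M(g)F_z(t)-I)\alpha=0\}.$$ (iii) If moreover $\nabla H\ne0$ everywhere on $\Sigma_E$ and $|t|<T$, this kernel coincides with $\ker d_{(t,z)}\Psi_g$, where $\Psi_g(s,w)=M(g)\Phi_s(w)-w$ for $w\in\Sigma_E$ and $s\in\,]-T,T[$ (with $(s,w)\in\mathcal{D}$). -/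

import Mathlib

open scoped ContDiff

noncomputable section

namespace ReducedPhase

/-- The phase space `ℝ^{2d}`, with coordinates `z = (q, p)`: `q` is indexed by the left copy of
`Fin d`, `p` by the right copy. It carries the Euclidean inner product. -/
abbrev PhaseSpace (d : ℕ) : Type := EuclideanSpace ℝ (Fin d ⊕ Fin d)

/-- A real `2d × 2d` matrix acting on phase space. -/
def act {d : ℕ} (A : Matrix (Fin d ⊕ Fin d) (Fin d ⊕ Fin d) ℝ) : PhaseSpace d →L[ℝ] PhaseSpace d :=
  Matrix.toEuclideanCLM (n := Fin d ⊕ Fin d) (𝕜 := ℝ) A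

/-- `J = (0 I; -I 0)`, as a linear map of phase space. -/
def J (d : ℕ) : PhaseSpace d →L[ℝ] PhaseSpace d :=
  act (Matrix.fromBlocks 0 1 (-1) 0)

/-- `M(g)(x, ξ) = (g x, ᵗg⁻¹ ξ)`, as a linear map of phase space. -/
def M {d : ℕ} (g : GL (Fin d) ℝ) : PhaseSpace d →L[ℝ] PhaseSpace d :=
  act (Matrix.fromBlocks (g : Matrix (Fin d) (Fin d) ℝ) 0 0
    ((g⁻¹ : GL (Fin d) ℝ) : Matrix (Fin d) (Fin d) ℝ).transpose)

/-- The Hamiltonian vector field `J ∇H`. -/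
def hamField {d : ℕ} (H : PhaseSpace d → ℝ) (z : PhaseSpace d) : PhaseSpace d :=
  J d (gradient H z)

/-- `γ` solves `ż = J ∇H(z)`, `z(0) = z`, on the closed interval with end points `0` and `t`. -/
def IsTrajectory {d : ℕ} (H : PhaseSpace d → ℝ) (t : ℝ) (z : PhaseSpace d)
    (γ : ℝ → PhaseSpace d) : Prop :=
  γ 0 = z ∧ IsIntegralCurveOn γ (fun _ => hamField H) (Set.uIcc 0 t)

/-- The set of the `(t, z)` such that the solution starting at `z` exists up to time `t`
(forward or backward): the maximal domain of the Hamiltonian flow. -/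
def flowDomain {d : ℕ} (H : PhaseSpace d → ℝ) : Set (ℝ × PhaseSpace d) :=
  {x | ∃ γ : ℝ → PhaseSpace d, IsTrajectory H x.1 x.2 γ}

open Classical in
/-- The Hamiltonian flow `Φ_t(z)` (with the irrelevant value `z` off its domain). -/
def flow {d : ℕ} (H : PhaseSpace d → ℝ) (t : ℝ) (z : PhaseSpace d) : PhaseSpace d :=
  if h : ∃ γ : ℝ → PhaseSpace d, IsTrajectory H t z γ then h.choose t else z

/-- `F_z(t) = ∂_z Φ_t(z)`. -/
def monodromy {d : ℕ} (H : PhaseSpace d → ℝ) (t : ℝ) (z : PhaseSpace d) :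
    PhaseSpace d →L[ℝ] PhaseSpace d :=
  fderiv ℝ (flow H t) z

/-- The matrix `(A B; C D)` of `F_z(t)`, with complex entries. -/
def monodromyMatrix {d : ℕ} (H : PhaseSpace d → ℝ) (t : ℝ) (z : PhaseSpace d) :
    Matrix (Fin d ⊕ Fin d) (Fin d ⊕ Fin d) ℂ :=
  Matrix.of fun i j => ((monodromy H t z (EuclideanSpace.single j 1) i : ℝ) : ℂ)

/-- `M₀ = (C + iD)(A + iB)⁻¹`. -/
def M₀ {d : ℕ} (H : PhaseSpace d → ℝ) (t : ℝ) (z : PhaseSpace d) : Matrix (Fin d) (Fin d) ℂ :=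
  let F := monodromyMatrix H t z
  (F.toBlocks₂₁ + Complex.I • F.toBlocks₂₂) * (F.toBlocks₁₁ + Complex.I • F.toBlocks₁₂)⁻¹

/-- The matrix `W_t`, defined by `(I + W_t)/2 = (I - i ᵗg⁻¹ M₀ g⁻¹)⁻¹`. -/
def W {d : ℕ} (H : PhaseSpace d → ℝ) (g : GL (Fin d) ℝ) (t : ℝ) (z : PhaseSpace d) :
    Matrix (Fin d) (Fin d) ℂ :=
  let k : Matrix (Fin d) (Fin d) ℂ :=
    ((g⁻¹ : GL (Fin d) ℝ) : Matrix (Fin d) (Fin d) ℝ).map (fun x : ℝ => (x : ℂ))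
  (2 : ℂ) • (1 - Complex.I • (k.transpose * M₀ H t z * k))⁻¹ - 1

/-- `Ŵ_t = (W_t, -i W_t; -i W_t, -W_t)`. -/
def What {d : ℕ} (H : PhaseSpace d → ℝ) (g : GL (Fin d) ℝ) (t : ℝ) (z : PhaseSpace d) :
    Matrix (Fin d ⊕ Fin d) (Fin d ⊕ Fin d) ℂ :=
  let w := W H g t z
  Matrix.fromBlocks w (-(Complex.I • w)) (-(Complex.I • w)) (-w)

/-- `φ₁(t,z) = (E - H(z)) t + ½⟨M(g)⁻¹z, Jz⟩ - ½ ∫₀ᵗ ⟨z_s - M(g)⁻¹z, J ż_s⟩ ds`,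
where `z_s = Φ_s(z)` and `ż_s = J∇H(z_s)`. -/
def phase₁ {d : ℕ} (H : PhaseSpace d → ℝ) (E : ℝ) (g : GL (Fin d) ℝ) (x : ℝ × PhaseSpace d) : ℝ :=
  (E - H x.2) * x.1 + (1 / 2) * inner ℝ (M g⁻¹ x.2) (J d x.2)
    - (1 / 2) * ∫ s in (0 : ℝ)..x.1,
        inner ℝ (flow H s x.2 - M g⁻¹ x.2) (J d (hamField H (flow H s x.2)))

/-- `φ₂(t,z) = ¼⟨(I - Ŵ_t) y, y⟩`, `y = M(g)z_t - z`, with the bilinear (not sesquilinear) pairing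
of `ℂ^{2d}`. -/
def phase₂ {d : ℕ} (H : PhaseSpace d → ℝ) (g : GL (Fin d) ℝ) (x : ℝ × PhaseSpace d) : ℂ :=
  let y : Fin d ⊕ Fin d → ℂ := fun i => (((M g (flow H x.1 x.2) - x.2) i : ℝ) : ℂ)
  (1 / 4) * (Matrix.mulVec (1 - What H g x.1 x.2) y ⬝ᵥ y)

/-- The complex phase `φ_{E,g} = φ₁ + i φ₂`. -/
def phase {d : ℕ} (H : PhaseSpace d → ℝ) (E : ℝ) (g : GL (Fin d) ℝ) (x : ℝ × PhaseSpace d) : ℂ :=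
  (phase₁ H E g x : ℂ) + Complex.I * phase₂ H g x

/-- The critical set of the phase: the points where its imaginary part vanishes and its gradient
(exists and) vanishes. -/
def criticalSet {d : ℕ} (H : PhaseSpace d → ℝ) (E : ℝ) (g : GL (Fin d) ℝ) :
    Set (ℝ × PhaseSpace d) :=
  {x | x ∈ flowDomain H ∧ (phase H E g x).im = 0 ∧
    HasFDerivAt (phase H E g) (0 : ℝ × PhaseSpace d →L[ℝ] ℂ) x}

/-- The real kernel of the Hessian of a complex function `f` at `x`: the real vectors `v` with
`D²f(x)(v, w) = 0` for all `w`. -/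
def realKerHess {V : Type*} [NormedAddCommGroup V] [NormedSpace ℝ V] (f : V → ℂ) (x : V) : Set V :=
  {v | ∀ w, fderiv ℝ (fderiv ℝ f) x v w = 0}

/-- The tangent vectors at `x` to a subset `S`: the velocities of the curves in `S` through `x`. -/
def tangentVectors {V : Type*} [NormedAddCommGroup V] [NormedSpace ℝ V] (S : Set V) (x : V) :
    Set V :=
  {v | ∃ c : ℝ → V, c 0 = x ∧ (∀ᶠ s in nhds (0 : ℝ), c s ∈ S) ∧ HasDerivAt c v 0}

/-- `(t, z) ↦ M(g)Φ_t(z) - z`, whose restriction to `]-T,T[ × Σ_E` is `Ψ_g`. -/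
def Psi {d : ℕ} (H : PhaseSpace d → ℝ) (g : GL (Fin d) ℝ) (x : ℝ × PhaseSpace d) : PhaseSpace d :=
  M g (flow H x.1 x.2) - x.2

/-- The kernel of the differential at `x` of `Ψ_g : ]-T,T[ × Σ_E → ℝ^{2d}`: the vectors tangent to
`]-T,T[ × Σ_E` at `x` that are killed by the differential. -/
def kerDPsi {d : ℕ} (H : PhaseSpace d → ℝ) (E T : ℝ) (g : GL (Fin d) ℝ) (x : ℝ × PhaseSpace d) :
    Set (ℝ × PhaseSpace d) :=
  {v | v ∈ tangentVectors (Set.Ioo (-T) T ×ˢ {z | H z = E}) x ∧ fderiv ℝ (Psi H g) x v = 0}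

end ReducedPhase

end

/-! Everything is expressed through the displacement `Psi`, written Ψ. The differential of φ₁ is τ(E
− H) − ½⟨Ψ, J(dΨ v + 2α)⟩ at v = (τ, α) (`fderiv_phase₁`), and φ₂ is a quadratic form in Ψ whose
real part is positive definite (`re_What_form_pos`). Since Im φ = Re φ₂, the imaginary part vanishes
exactly where Ψ = 0. There φ₂ vanishes to second order, so dφ = τ(E − H), and the critical set
follows. At such a point the Hessian of φ₂ is the polarized form evaluated on dΨ v and dΨ w. Pairing
a real kernel vector with itself and taking imaginary parts forces dΨ v = 0, after which only −w₁⟨α,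
∇H⟩ is left (`realKerHess_eq`). Equivariance of the Hamiltonian field (`M_hamField`) makes dΨ
explicit at a fixed point, and on a regular level the condition α ⊥ ∇H is tangency
(`tangentVectors_prod_level`).

Positivity: F is symplectic, so Im⟨(A+iB)v, (C+iD)v⟩ = |v|². Hence A+iB is invertible and M₀ has
positive imaginary part, which survives the congruence by g⁻¹. The Cayley transform W is then a
strict contraction, and with y = (a, b), η = a − ib one has ⟨(I − Ŵ)y, y⟩ = |η|² − ⟨Wη, η⟩.

Smoothness: with time rescaled to [0, 1], trajectories are zeros of a smooth map on a Banach space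
of curves. Its derivative in the curve is the identity minus a Volterra operator, always invertible,
so the implicit function theorem applies near any trajectory, however long
(`exists_contDiffAt_flow`). Openness of the domain comes with it. Completeness follows by slowing
the field down by a function of the conserved energy. -/

noncomputable section

namespace SmoothFlow

open Set Filter Topology

/-! ### Smoothness of superposition operators on spaces of continuous curves. -/

section Superposition

universe u

variable {I : Type*} [TopologicalSpace I] [CompactSpace I]
  {E : Type u} [NormedAddCommGroup E] [NormedSpace ℝ E]
  {F : Type u} [NormedAddCommGroup F] [NormedSpace ℝ F]

/-- Pointwise application of a continuous family of operators to a continuous function. -/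
def pointwiseApply : C(I, E →L[ℝ] F) →L[ℝ] C(I, E) →L[ℝ] C(I, F) :=
  LinearMap.mkContinuous₂
    (LinearMap.mk₂ ℝ (fun (a : C(I, E →L[ℝ] F)) (h : C(I, E)) =>
        (⟨fun s => a s (h s), by fun_prop⟩ : C(I, F)))
      (fun a b h => by ext; simp) (fun c a h => by ext; simp)
      (fun a h k => by ext; simp) (fun c a h => by ext; simp)) 1
    (fun a h => by
      rw [one_mul, ContinuousMap.norm_le _ (by positivity)]
      intro s
      exact ((a s).le_opNorm _).trans
        (mul_le_mul (a.norm_coe_le_norm s) (h.norm_coe_le_norm s) (norm_nonneg _) (norm_nonneg a)))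

@[simp]
lemma pointwiseApply_apply (a : C(I, E →L[ℝ] F)) (h : C(I, E)) (s : I) :
    pointwiseApply a h s = a s (h s) := rfl

/-- The superposition operator `γ ↦ f ∘ γ` is differentiable on continuous functions. -/
lemma hasFDerivAt_comp_continuousMap (f : C(E, F)) (f' : C(E, E →L[ℝ] F))
    (hf : ∀ x, HasFDerivAt f (f' x) x) (γ : C(I, E)) :
    HasFDerivAt (fun η : C(I, E) => f.comp η) (pointwiseApply (f'.comp γ)) γ := by
  rw [hasFDerivAt_iff_isLittleO_nhds_zero, Asymptotics.isLittleO_iff]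
  intro ε hε
  -- Continuity of `η ↦ f' ∘ η` in the uniform norm plays the role of uniform continuity of `f'`
  -- near the image of `γ`, which is compact; no local compactness of `E` is needed.
  have hc : ContinuousAt (fun η : C(I, E) => f'.comp η) γ :=
    (ContinuousMap.continuous_postcomp f').continuousAt
  obtain ⟨δ, hδ, hball⟩ := (Metric.continuousAt_iff (α := C(I, E)) (β := C(I, E →L[ℝ] F))).1 hc ε hε
  filter_upwards [Metric.ball_mem_nhds (0 : C(I, E)) hδ] with h hh
  rw [mem_ball_zero_iff] at hh
  rw [ContinuousMap.norm_le _ (by positivity)]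
  intro s
  have key := Convex.norm_image_sub_le_of_norm_hasFDerivWithin_le' (𝕜 := ℝ) (f := f) (C := ε)
    (s := segment ℝ (γ s) (γ s + h s)) (x := γ s) (y := γ s + h s) (f' := f') (φ := f' (γ s))
    (fun x _ => (hf x).hasFDerivWithinAt) ?_ (convex_segment _ _) (left_mem_segment _ _ _)
    (right_mem_segment _ _ _)
  · rw [add_sub_cancel_left] at key
    refine key.trans ?_
    gcongr
    exact h.norm_coe_le_norm s
  · intro x hx
    rw [segment_eq_image'] at hx
    obtain ⟨θ, hθ, rfl⟩ := hx
    -- The point of the segment is the value at `s` of the curve `γ + θ • h`, which stays in the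
    -- `δ`-ball around `γ`.
    have h1 : dist (γ + θ • h) γ < δ := by
      rw [dist_eq_norm, add_sub_cancel_left, norm_smul, Real.norm_eq_abs, abs_of_nonneg hθ.1]
      exact (mul_le_of_le_one_left (norm_nonneg _) hθ.2).trans_lt hh
    have h2 := (ContinuousMap.dist_apply_le_dist (f := f'.comp (γ + θ • h)) (g := f'.comp γ) s).trans
      (hball h1).le
    rw [dist_eq_norm] at h2
    simpa using h2

/-- The superposition operator `γ ↦ f ∘ γ` with a smooth `f` is smooth on continuous functions. -/
lemma contDiff_comp_continuousMap (f : C(E, F)) (hf : ContDiff ℝ ∞ f) :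
    ContDiff ℝ ∞ (fun η : C(I, E) => f.comp η) := by
  rw [contDiff_infty]
  intro n
  -- The target must vary, since the inductive step replaces `f` by `fderiv ℝ f`, valued in `E →L[ℝ]
  -- F`; hence the common universe of `E` and `F`.
  induction n generalizing F with
  | zero => exact contDiff_zero.2 (ContinuousMap.continuous_postcomp f)
  | succ n ih =>
    have hf' : ContDiff ℝ ∞ (fderiv ℝ f) := hf.fderiv_right (by simp)
    have hd : ∀ γ : C(I, E), HasFDerivAt (fun η : C(I, E) => f.comp η)
        (pointwiseApply ((⟨fderiv ℝ f, hf'.continuous⟩ : C(E, E →L[ℝ] F)).comp γ)) γ :=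
      fun γ => hasFDerivAt_comp_continuousMap f ⟨fderiv ℝ f, hf'.continuous⟩
        (fun x => (hf.differentiable (by simp) x).hasFDerivAt) γ
    rw [Nat.cast_add, Nat.cast_one, contDiff_succ_iff_fderiv]
    refine ⟨fun γ => (hd γ).differentiableAt, by simp, ?_⟩
    have : fderiv ℝ (fun η : C(I, E) => f.comp η) = fun γ =>
        pointwiseApply ((⟨fderiv ℝ f, hf'.continuous⟩ : C(E, E →L[ℝ] F)).comp γ) :=
      funext fun γ => (hd γ).fderiv
    rw [this]
    exact pointwiseApply.contDiff.comp (ih ⟨fderiv ℝ f, hf'.continuous⟩ hf')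

end Superposition

/-! ### Linear Volterra equations on the unit interval. -/

section Primitive

variable {E : Type*} [NormedAddCommGroup E]

/-- The continuous extension of a function on the unit interval to the line. -/
def extend (h : C(unitInterval, E)) (s : ℝ) : E := h (projIcc 0 1 zero_le_one s)

lemma continuous_extend (h : C(unitInterval, E)) : Continuous (extend h) :=
  h.continuous.comp continuous_projIcc

lemma extend_coe (h : C(unitInterval, E)) (s : unitInterval) : extend h s = h s := by
  simp [extend]

lemma extend_of_mem (h : C(unitInterval, E)) {s : ℝ} (hs : s ∈ Icc (0 : ℝ) 1) :
    extend h s = h ⟨s, hs⟩ :=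
  extend_coe h ⟨s, hs⟩

lemma norm_extend_le (h : C(unitInterval, E)) (s : ℝ) : ‖extend h s‖ ≤ ‖h‖ := h.norm_coe_le_norm _

lemma intervalIntegrable_extend (h : C(unitInterval, E)) (a b : ℝ) :
    IntervalIntegrable (extend h) MeasureTheory.volume a b :=
  (continuous_extend h).intervalIntegrable _ _

variable [NormedSpace ℝ E]

/-- The primitive vanishing at `0` of a continuous function on the unit interval. -/
def primitive : C(unitInterval, E) →L[ℝ] C(unitInterval, E) :=
  LinearMap.mkContinuous
    { toFun := fun h => ⟨fun s => ∫ σ in (0 : ℝ)..s, extend h σ,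
        (intervalIntegral.continuous_primitive (intervalIntegrable_extend h) 0).comp
          continuous_subtype_val⟩
      map_add' := fun h k => by
        ext s
        exact intervalIntegral.integral_add (intervalIntegrable_extend h _ _)
          (intervalIntegrable_extend k _ _)
      map_smul' := fun c h => by
        ext s
        exact intervalIntegral.integral_smul c (extend h) } 1
    (fun h => by
      rw [one_mul, ContinuousMap.norm_le _ (norm_nonneg _)]
      intro s
      refine (intervalIntegral.norm_integral_le_of_norm_le_const
        (fun σ _ => norm_extend_le h σ)).trans ?_
      rw [sub_zero, abs_of_nonneg s.2.1]
      exact mul_le_of_le_one_right (norm_nonneg _) s.2.2)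

lemma primitive_apply (h : C(unitInterval, E)) (s : unitInterval) :
    primitive h s = ∫ σ in (0 : ℝ)..s, extend h σ := rfl

/-- Each application integrates the previous bound from `0` to `s`, which turns `sⁿ/n!` into
`sⁿ⁺¹/(n+1)!`. Keeping the dependence on `s` is what produces the factorial, and thus a power of the
operator with norm below 1 whatever the size of `a`. -/
lemma norm_volterra_pow_apply_le (a : C(unitInterval, E →L[ℝ] E)) (h : C(unitInterval, E)) (n : ℕ)
    (s : unitInterval) :
    ‖((primitive ∘L pointwiseApply a) ^ n) h s‖
      ≤ ‖a‖ ^ n * ((s : ℝ) ^ n / n.factorial) * ‖h‖ := by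
  induction n generalizing s with
  | zero => simpa using h.norm_coe_le_norm s
  | succ n ih =>
    rw [pow_succ', mul_apply_eq_comp, ContinuousLinearMap.comp_apply, primitive_apply]
    set k := ((primitive ∘L pointwiseApply a) ^ n) h
    have hint : ∫ σ in (0 : ℝ)..s, ‖a‖ * (‖a‖ ^ n * (σ ^ n / n.factorial) * ‖h‖)
        = ‖a‖ ^ (n + 1) * ((s : ℝ) ^ (n + 1) / (n + 1).factorial) * ‖h‖ := by
      have : (fun σ : ℝ => ‖a‖ * (‖a‖ ^ n * (σ ^ n / n.factorial) * ‖h‖))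
          = fun σ => (‖a‖ ^ (n + 1) * ‖h‖ / n.factorial) * σ ^ n := by
        funext σ; ring
      rw [this, intervalIntegral.integral_const_mul, integral_pow, Nat.factorial_succ]
      push_cast
      have : (n.factorial : ℝ) ≠ 0 := by positivity
      field_simp
      simp
    rw [← hint]
    refine intervalIntegral.norm_integral_le_of_norm_le s.2.1 ?_
      (Continuous.intervalIntegrable (by fun_prop) _ _)
    refine Eventually.of_forall fun σ hσ => ?_
    have hσ' : σ ∈ Icc (0 : ℝ) 1 := ⟨hσ.1.le, hσ.2.trans s.2.2⟩
    rw [extend_of_mem _ hσ', pointwiseApply_apply]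
    exact ((a _).le_opNorm _).trans
      (mul_le_mul (a.norm_coe_le_norm _) (ih ⟨σ, hσ'⟩) (norm_nonneg _) (norm_nonneg a))

variable [CompleteSpace E]

/-- Linear Volterra equations are uniquely solvable. -/
lemma isUnit_one_sub_volterra (a : C(unitInterval, E →L[ℝ] E)) :
    IsUnit (1 - primitive ∘L pointwiseApply a : C(unitInterval, E) →L[ℝ] C(unitInterval, E)) := by
  set V : C(unitInterval, E) →L[ℝ] C(unitInterval, E) := primitive ∘L pointwiseApply a with hV
  obtain ⟨n, hn⟩ : ∃ n : ℕ, ‖a‖ ^ n / n.factorial < 1 :=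
    ((FloorSemiring.tendsto_pow_div_factorial_atTop ‖a‖).eventually_lt_const one_pos).exists
  have hVn : ‖V ^ n‖ < 1 := by
    refine (ContinuousLinearMap.opNorm_le_bound _ (by positivity) fun h => ?_).trans_lt hn
    rw [ContinuousMap.norm_le _ (by positivity)]
    intro s
    refine (norm_volterra_pow_apply_le a h n s).trans ?_
    rw [mul_div_assoc']
    gcongr
    exact mul_le_of_le_one_right (by positivity) (pow_le_one₀ s.2.1 s.2.2)
  have hu : IsUnit (1 - V ^ n) := isUnit_one_sub_of_norm_lt_one
    (R := C(unitInterval, E) →L[ℝ] C(unitInterval, E)) hVn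
  -- `1 - V ^ n` is the product of `1 - V` with a geometric sum commuting with it, so both factors
  -- are units.
  rw [← mul_neg_geom_sum] at hu
  have hcomm : Commute (1 - V) (∑ i ∈ Finset.range n, V ^ i) := by
    rw [Commute, SemiconjBy, mul_neg_geom_sum, geom_sum_mul_neg]
  exact (hcomm.isUnit_mul_iff.1 hu).1

end Primitive

end SmoothFlow

end

/-! ### Smooth dependence of integral curves on time and initial value. -/

noncomputable section

namespace SmoothFlow

open Set Filter Topology

universe u

variable {E : Type u} [NormedAddCommGroup E] [NormedSpace ℝ E]

/-- Integral curves of a `C¹` vector field with the same initial value coincide. -/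
lemma eqOn_of_isIntegralCurveOn {X : E → E} (hX : ContDiff ℝ 1 X) {t : ℝ} {γ γ' : ℝ → E}
    (hγ : IsIntegralCurveOn γ (fun _ => X) (uIcc 0 t))
    (hγ' : IsIntegralCurveOn γ' (fun _ => X) (uIcc 0 t)) (h0 : γ 0 = γ' 0) :
    EqOn γ γ' (uIcc 0 t) := by
  -- Both curves stay in one compact set, on which the field is globally Lipschitz.
  have hK : IsCompact (γ '' uIcc 0 t ∪ γ' '' uIcc 0 t) :=
    (isCompact_uIcc.image_of_continuousOn hγ.continuousOn).union
      (isCompact_uIcc.image_of_continuousOn hγ'.continuousOn)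
  obtain ⟨K, hK⟩ := (hX.locallyLipschitz.locallyLipschitzOn).exists_lipschitzOnWith_of_compact hK
  have hmem : ∀ s ∈ uIcc 0 t, γ s ∈ γ '' uIcc 0 t ∪ γ' '' uIcc 0 t :=
    fun s hs => Or.inl (mem_image_of_mem _ hs)
  have hmem' : ∀ s ∈ uIcc 0 t, γ' s ∈ γ '' uIcc 0 t ∪ γ' '' uIcc 0 t :=
    fun s hs => Or.inr (mem_image_of_mem _ hs)
  rcases le_total 0 t with ht | ht
  · rw [uIcc_of_le ht] at *
    refine ODE_solution_unique_of_mem_Icc_right (v := fun _ => X) (fun _ _ => hK)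
      hγ.continuousOn (fun s hs => ?_) (fun s hs => hmem s (Ico_subset_Icc_self hs))
      hγ'.continuousOn (fun s hs => ?_) (fun s hs => hmem' s (Ico_subset_Icc_self hs)) h0
    · exact ((hγ s (Ico_subset_Icc_self hs)).mono (Icc_subset_Icc_left hs.1))
        |>.mono_of_mem_nhdsWithin (Icc_mem_nhdsGE hs.2)
    · exact ((hγ' s (Ico_subset_Icc_self hs)).mono (Icc_subset_Icc_left hs.1))
        |>.mono_of_mem_nhdsWithin (Icc_mem_nhdsGE hs.2)
  · rw [uIcc_of_ge ht] at *
    refine ODE_solution_unique_of_mem_Icc_left (v := fun _ => X) (fun _ _ => hK)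
      hγ.continuousOn (fun s hs => ?_) (fun s hs => hmem s (Ioc_subset_Icc_self hs))
      hγ'.continuousOn (fun s hs => ?_) (fun s hs => hmem' s (Ioc_subset_Icc_self hs)) h0
    · exact ((hγ s (Ioc_subset_Icc_self hs)).mono (Icc_subset_Icc_right hs.2))
        |>.mono_of_mem_nhdsWithin (Icc_mem_nhdsLE hs.1)
    · exact ((hγ' s (Ioc_subset_Icc_self hs)).mono (Icc_subset_Icc_right hs.2))
        |>.mono_of_mem_nhdsWithin (Icc_mem_nhdsLE hs.1)

/-- The integral equation, in rescaled time, of the integral curves of `X`. -/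
def integralEquation (X : C(E, E)) (x : (ℝ × E) × C(unitInterval, E)) : C(unitInterval, E) :=
  x.2 - ContinuousLinearMap.const ℝ unitInterval x.1.2 - x.1.1 • primitive (X.comp x.2)

lemma contDiff_integralEquation (X : C(E, E)) (hX : ContDiff ℝ ∞ X) :
    ContDiff ℝ ∞ (integralEquation X) := by
  have h := contDiff_comp_continuousMap (I := unitInterval) X hX
  unfold integralEquation
  fun_prop

variable [CompleteSpace E]

/-- The partial derivative in the curve is the identity minus the Volterra operator with kernel `t •
X'(η)`. This is the hypothesis of the implicit function theorem, with no smallness of `t`. -/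
lemma isInvertible_fderiv_integralEquation (X : C(E, E)) (hX : ContDiff ℝ ∞ X)
    (x : (ℝ × E) × C(unitInterval, E)) :
    (fderiv ℝ (integralEquation X) x ∘L
      .inr ℝ (ℝ × E) C(unitInterval, E)).IsInvertible := by
  have hX' : ContDiff ℝ ∞ (fderiv ℝ X) := hX.fderiv_right (by simp)
  set X' : C(E, E →L[ℝ] E) := ⟨fderiv ℝ X, hX'.continuous⟩
  have h1 : HasFDerivAt (fun η => integralEquation X (x.1, η))
      (fderiv ℝ (integralEquation X) x ∘L .inr ℝ (ℝ × E) C(unitInterval, E)) x.2 :=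
    HasFDerivAt.comp (g := integralEquation X) (f := fun η => (x.1, η)) x.2
      ((contDiff_integralEquation X hX).differentiable (by simp) x).hasFDerivAt
      (hasFDerivAt_prodMk_right (𝕜 := ℝ) x.1 x.2)
  have h2 : HasFDerivAt (fun η => integralEquation X (x.1, η))
      (1 - primitive ∘L pointwiseApply (x.1.1 • X'.comp x.2)) x.2 := by
    have h3 := hasFDerivAt_comp_continuousMap X X'
      (fun y => (hX.differentiable (by simp) y).hasFDerivAt) x.2
    have h4 := ((hasFDerivAt_id x.2).sub_const
      (ContinuousLinearMap.const ℝ unitInterval x.1.2)).sub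
        ((primitive.hasFDerivAt.comp x.2 h3).const_smul x.1.1)
    refine h4.congr_fderiv ?_
    ext h s
    simp
  rw [h1.unique h2]
  obtain ⟨e, he⟩ := isUnit_one_sub_volterra (x.1.1 • X'.comp x.2)
  rw [← he]
  exact ContinuousLinearMap.IsInvertible.of_inverse (g := e.inv) e.mul_inv e.inv_mul

lemma integralEquation_eq_zero_of_isIntegralCurveOn (X : C(E, E)) {t : ℝ} {γ : ℝ → E}
    (hγ : IsIntegralCurveOn γ (fun _ => X) (uIcc 0 t)) :
    ∃ η : C(unitInterval, E), integralEquation X ((t, γ 0), η) = 0 ∧ η 1 = γ t := by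
  have hsub : ∀ s ∈ Icc (0 : ℝ) 1, s * t ∈ uIcc 0 t := by
    intro s hs
    rw [mem_uIcc]
    rcases le_total 0 t with ht | ht
    · exact Or.inl ⟨mul_nonneg hs.1 ht, mul_le_of_le_one_left ht hs.2⟩
    · exact Or.inr ⟨by nlinarith [hs.1, hs.2], mul_nonpos_of_nonneg_of_nonpos hs.1 ht⟩
  have hβ := (hγ.comp_mul t).mono (s' := Icc 0 1) hsub
  have hc := hβ.continuousOn
  set β : ℝ → E := γ ∘ fun x => x * t
  set η : C(unitInterval, E) := ⟨fun s => β s, continuousOn_iff_continuous_domRestrict.1 hc⟩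
  refine ⟨η, ?_, by simp [η, β]⟩
  ext s
  have hint : ∫ σ in (0 : ℝ)..s, t • extend (X.comp η) σ = β s - β 0 := by
    refine intervalIntegral.integral_eq_sub_of_hasDerivAt_of_le s.2.1
      (hc.mono (Icc_subset_Icc_right s.2.2)) (fun σ hσ => ?_)
      (((continuous_extend _).const_smul t).intervalIntegrable _ _)
    have hσ' : σ ∈ Icc (0 : ℝ) 1 := ⟨hσ.1.le, hσ.2.le.trans s.2.2⟩
    rw [extend_of_mem _ hσ']
    exact (hβ σ hσ').hasDerivAt (Icc_mem_nhds hσ.1 (hσ.2.trans_le s.2.2))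
  rw [intervalIntegral.integral_smul] at hint
  simp only [integralEquation, ContinuousMap.sub_apply, ContinuousMap.smul_apply, primitive_apply,
    hint]
  simp [η, β]

lemma isIntegralCurveOn_of_integralEquation_eq_zero (X : C(E, E)) {t : ℝ} {z : E}
    {η : C(unitInterval, E)} (h : integralEquation X ((t, z), η) = 0) :
    ∃ γ : ℝ → E, γ 0 = z ∧ IsIntegralCurveOn γ (fun _ => X) (uIcc 0 t) ∧ γ t = η 1 := by
  have heq : ∀ s : unitInterval, η s = z + t • ∫ σ in (0 : ℝ)..s, extend (X.comp η) σ := by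
    intro s
    have := congrArg (fun f : C(unitInterval, E) => f s) h
    simp only [integralEquation, ContinuousMap.sub_apply, sub_sub, ContinuousMap.zero_apply,
      sub_eq_zero] at this
    exact this
  have h0 : η 0 = z := by simpa using heq 0
  -- Undoing the rescaling divides by `t`; for `t = 0` the interval is a point and the constant
  -- curve serves.
  rcases eq_or_ne t 0 with rfl | ht
  · refine ⟨fun _ => z, rfl, ?_, by simpa using (heq 1).symm⟩
    intro s hs
    rw [uIcc_self] at hs ⊢
    exact HasFDerivWithinAt.of_subsingleton subsingleton_singleton
  · have hβ : IsIntegralCurveOn (extend η) (fun _ x => t • X x) (Icc 0 1) := by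
      intro s hs
      have hd : HasDerivAt (fun s : ℝ => z + t • ∫ σ in (0 : ℝ)..s, extend (X.comp η) σ)
          (t • extend (X.comp η) s) s :=
        ((intervalIntegral.integral_hasDerivAt_right (intervalIntegrable_extend _ _ _)
          ((continuous_extend _).stronglyMeasurableAtFilter _ _)
          (continuous_extend _).continuousAt).const_smul t).const_add z
      refine (hd.hasDerivWithinAt).congr_of_mem (fun s' hs' => ?_) hs
      rw [extend_of_mem _ hs', heq]
    have hγ := hβ.comp_mul t⁻¹
    refine ⟨extend η ∘ fun x => x * t⁻¹, ?_, ?_, ?_⟩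
    · simpa [h0] using extend_coe η 0
    · have h1 : (t⁻¹ • (fun (_ : ℝ) x => t • X x) ∘ fun x => x * t⁻¹) = fun _ x => X x := by
        funext s x
        simp [smul_smul, inv_mul_cancel₀ ht]
      rw [h1] at hγ
      refine hγ.mono fun s hs => ?_
      rw [mem_uIcc] at hs
      rw [mem_ofPred_eq, ← div_eq_mul_inv]
      rcases hs with hs | hs
      · exact ⟨div_nonneg hs.1 (hs.1.trans hs.2), div_le_one_of_le₀ hs.2 (hs.1.trans hs.2)⟩
      · exact ⟨div_nonneg_of_nonpos hs.2 (hs.1.trans hs.2), div_le_one_of_ge hs.1 (hs.1.trans hs.2)⟩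
    · simpa [mul_inv_cancel₀ ht] using extend_coe η 1

/-- Smooth dependence on time and initial value, near an arbitrary integral curve: nearby integral
curves exist up to nearby times, and their end points depend smoothly on both data. -/
theorem exists_contDiffAt_flow {X : E → E} (hX : ContDiff ℝ ∞ X) {t₀ : ℝ} {γ₀ : ℝ → E}
    (hγ₀ : IsIntegralCurveOn γ₀ (fun _ => X) (uIcc 0 t₀)) :
    ∃ Φ : ℝ × E → E, ContDiffAt ℝ ∞ Φ (t₀, γ₀ 0) ∧ ∀ᶠ x in 𝓝 (t₀, γ₀ 0), ∃ γ : ℝ → E,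
      γ 0 = x.2 ∧ IsIntegralCurveOn γ (fun _ => X) (uIcc 0 x.1) ∧ γ x.1 = Φ x := by
  set Xc : C(E, E) := ⟨X, hX.continuous⟩
  obtain ⟨η, hη, -⟩ := integralEquation_eq_zero_of_isIntegralCurveOn Xc hγ₀
  have hP : ContDiffAt ℝ ∞ (integralEquation Xc) ((t₀, γ₀ 0), η) :=
    (contDiff_integralEquation Xc hX).contDiffAt
  have hinv := isInvertible_fderiv_integralEquation Xc hX ((t₀, γ₀ 0), η)
  refine ⟨fun x => hP.implicitFunction (by simp) hinv x 1,
    ContDiffAt.continuousLinearMap_comp (f := hP.implicitFunction (by simp) hinv)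
      (x := (t₀, γ₀ 0)) (ContinuousMap.evalCLM ℝ (1 : unitInterval))
      (hP.contDiffAt_implicitFunction (by simp) hinv), ?_⟩
  filter_upwards [hP.eventually_apply_implicitFunction (by simp) hinv] with x hx
  exact isIntegralCurveOn_of_integralEquation_eq_zero Xc (hx.trans hη)

/-- Smooth dependence on time and initial value of the integral of a smooth function along
integral curves. -/
theorem exists_contDiffAt_integral {X : E → E} (hX : ContDiff ℝ ∞ X) {f : E × E → ℝ}
    (hf : ContDiff ℝ ∞ f) {t₀ : ℝ} {γ₀ : ℝ → E}
    (hγ₀ : IsIntegralCurveOn γ₀ (fun _ => X) (uIcc 0 t₀)) :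
    ∃ Φ : ℝ × E → ℝ, ContDiffAt ℝ ∞ Φ (t₀, γ₀ 0) ∧ ∀ᶠ x in 𝓝 (t₀, γ₀ 0), ∃ γ : ℝ → E,
      γ 0 = x.2 ∧ IsIntegralCurveOn γ (fun _ => X) (uIcc 0 x.1) ∧
        ∫ s in (0 : ℝ)..x.1, f (γ s, x.2) = Φ x := by
  -- The system is augmented by a frozen copy of the initial point and by the running integral, so
  -- that smoothness of the integral becomes smoothness of a flow.
  set Y : E × E × ℝ → E × E × ℝ := fun y => (X y.1, 0, f (y.1, y.2.1)) with hYdef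
  have hY : ContDiff ℝ ∞ Y := by fun_prop
  have hFc : ContinuousOn (fun s => f (γ₀ s, γ₀ 0)) (uIcc 0 t₀) :=
    hf.continuous.comp_continuousOn (hγ₀.continuousOn.prodMk continuousOn_const)
  have hcurve : IsIntegralCurveOn (fun s => (γ₀ s, γ₀ 0, ∫ r in (0 : ℝ)..s, f (γ₀ r, γ₀ 0)))
      (fun _ => Y) (uIcc 0 t₀) := by
    intro s hs
    refine (hγ₀ s hs).prodMk ((hasDerivWithinAt_const _ _ _).prodMk ?_)
    -- This instance gives the fundamental theorem of calculus within the closed interval, end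
    -- points included.
    have : Fact (s ∈ Icc (min 0 t₀) (max 0 t₀)) := ⟨hs⟩
    change HasDerivWithinAt _ _ (Icc (min 0 t₀) (max 0 t₀)) s
    exact intervalIntegral.integral_hasDerivWithinAt_right
      ((hFc.mono (uIcc_subset_uIcc_left hs)).intervalIntegrable)
      (hFc.stronglyMeasurableAtFilter_nhdsWithin measurableSet_uIcc s) (hFc s hs)
  obtain ⟨Φ, hΦ, hev⟩ := exists_contDiffAt_flow hY hcurve
  rw [intervalIntegral.integral_same] at hΦ hev
  have hι : ContDiff ℝ ∞ (fun x : ℝ × E => ((x.1, (x.2, x.2, 0)) : ℝ × (E × E × ℝ))) := by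
    fun_prop
  have hΦ' : ContDiffAt ℝ ∞ (fun x : ℝ × E => Φ (x.1, (x.2, x.2, 0))) (t₀, γ₀ 0) :=
    ContDiffAt.comp (g := Φ) (t₀, γ₀ 0) hΦ hι.contDiffAt
  refine ⟨fun x => (Φ (x.1, (x.2, x.2, 0))).2.2, hΦ'.snd.snd, ?_⟩
  have hev' := (hι.continuous.tendsto (t₀, γ₀ 0)).eventually hev
  filter_upwards [hev'] with x ⟨γ, hγ0, hγ, hγt⟩
  have h1 : IsIntegralCurveOn (fun s => (γ s).1) (fun _ => X) (uIcc 0 x.1) := fun s hs =>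
    (ContinuousLinearMap.fst ℝ E (E × ℝ)).hasFDerivAt.comp_hasDerivWithinAt s (hγ s hs)
  have h2 : ∀ s ∈ uIcc 0 x.1, HasDerivWithinAt (fun s => (γ s).2.1) 0 (uIcc 0 x.1) s := fun s hs =>
    (ContinuousLinearMap.fst ℝ E ℝ ∘L
      ContinuousLinearMap.snd ℝ E (E × ℝ)).hasFDerivAt.comp_hasDerivWithinAt s (hγ s hs)
  have h3 : ∀ s ∈ uIcc 0 x.1, HasDerivWithinAt (fun s => (γ s).2.2) (f ((γ s).1, (γ s).2.1))
      (uIcc 0 x.1) s := fun s hs =>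
    (ContinuousLinearMap.snd ℝ E ℝ ∘L
      ContinuousLinearMap.snd ℝ E (E × ℝ)).hasFDerivAt.comp_hasDerivWithinAt s (hγ s hs)
  have hw : ∀ s ∈ uIcc 0 x.1, (γ s).2.1 = x.2 := by
    intro s hs
    have := eqOn_of_isIntegralCurveOn (X := fun _ : E => 0) contDiff_const (t := x.1)
      (γ := fun s => (γ s).2.1) (γ' := fun _ => x.2) h2
      (fun s _ => hasDerivWithinAt_const _ _ _) (by simp [hγ0])
    exact this hs
  refine ⟨fun s => (γ s).1, by simp [hγ0], h1, ?_⟩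
  have hc : ContinuousOn (fun s => f ((γ s).1, x.2)) (uIcc 0 x.1) :=
    hf.continuous.comp_continuousOn (h1.continuousOn.prodMk continuousOn_const)
  have hint := intervalIntegral.integral_eq_sub_of_hasDeriv_right (a := 0) (b := x.1)
    (f := fun s => (γ s).2.2) (f' := fun s => f ((γ s).1, x.2))
    (fun s hs => (h3 s hs).continuousWithinAt) (fun s hs => by
      have hs' : s ∈ uIcc 0 x.1 := Ioo_subset_Icc_self hs
      have := h3 s hs'
      rw [hw s hs'] at this
      exact (this.hasDerivAt (Icc_mem_nhds hs.1 hs.2)).hasDerivWithinAt) hc.intervalIntegrable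
  rw [hint, hγ0, hγt, sub_zero]

/-- The integral curves of a bounded locally Lipschitz vector field are defined for all times. -/
lemma exists_isIntegralCurveOn_of_bounded [ProperSpace E] {X : E → E} (hX : ContDiff ℝ 1 X)
    {C : ℝ} (hC : ∀ x, ‖X x‖ ≤ C) (t : ℝ) (z : E) :
    ∃ γ : ℝ → E, γ 0 = z ∧ IsIntegralCurveOn γ (fun _ => X) (uIcc 0 t) := by
  have hC0 : 0 ≤ C := (norm_nonneg _).trans (hC z)
  lift C to NNReal using hC0
  -- A curve of speed at most `C` moves at most `C * |t|` in time `|t|`, so a single Picard–Lindelöf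
  -- ball of this radius covers the whole interval.
  set a : NNReal := C * ‖t‖₊
  obtain ⟨K, hK⟩ := (hX.locallyLipschitz.locallyLipschitzOn).exists_lipschitzOnWith_of_compact
    (isCompact_closedBall z a)
  have hPL : IsPicardLindelof (fun _ => X) (tmin := min 0 t) (tmax := max 0 t)
      ⟨0, left_mem_uIcc⟩ z a 0 C K := by
    refine IsPicardLindelof.of_time_independent (fun x _ => hC x) hK ?_
    simp only [a, NNReal.coe_mul, coe_nnnorm, Real.norm_eq_abs, NNReal.coe_zero, sub_zero, zero_sub]
    gcongr
    rcases le_total 0 t with h | h <;> simp [h, abs_of_nonneg, abs_of_nonpos]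
  exact hPL.exists_eq_forall_mem_Icc_hasDerivWithinAt₀

end SmoothFlow

end

noncomputable section

namespace ReducedPhase

open Set Filter Topology SmoothFlow

variable {d : ℕ}

/-! ### Symplectic linear algebra of `J` and `M(g)`. -/

section Linear

lemma act_act (A B : Matrix (Fin d ⊕ Fin d) (Fin d ⊕ Fin d) ℝ) (x : PhaseSpace d) :
    act A (act B x) = act (A * B) x := by
  simp [act, map_mul]

@[simp]
lemma act_one (x : PhaseSpace d) : act 1 x = x := by
  simp [act]

lemma act_neg (A : Matrix (Fin d ⊕ Fin d) (Fin d ⊕ Fin d) ℝ) (x : PhaseSpace d) :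
    act (-A) x = -act A x := by
  simp [act]

lemma inner_act_left (A : Matrix (Fin d ⊕ Fin d) (Fin d ⊕ Fin d) ℝ) (x y : PhaseSpace d) :
    inner ℝ (act A x) y = inner ℝ x (act A.transpose y) := by
  have h : act A.transpose = ContinuousLinearMap.adjoint (act A) := by
    simp only [act]
    rw [← ContinuousLinearMap.star_eq_adjoint, ← map_star, Matrix.star_eq_conjTranspose,
      Matrix.conjTranspose_eq_transpose_of_trivial]
  rw [h, ContinuousLinearMap.adjoint_inner_right]

lemma J_J (x : PhaseSpace d) : J d (J d x) = -x := by
  have h : Matrix.fromBlocks (0 : Matrix (Fin d) (Fin d) ℝ) (1 : Matrix (Fin d) (Fin d) ℝ)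
      (-1 : Matrix (Fin d) (Fin d) ℝ) (0 : Matrix (Fin d) (Fin d) ℝ) *
      Matrix.fromBlocks 0 1 (-1) 0 = -1 := by
    simp [Matrix.fromBlocks_multiply, ← Matrix.fromBlocks_one, Matrix.fromBlocks_neg]
  rw [J, act_act, h, act_neg, act_one]

lemma inner_J_left (x y : PhaseSpace d) : inner ℝ (J d x) y = -inner ℝ x (J d y) := by
  have h : (Matrix.fromBlocks (0 : Matrix (Fin d) (Fin d) ℝ) (1 : Matrix (Fin d) (Fin d) ℝ)
      (-1 : Matrix (Fin d) (Fin d) ℝ) (0 : Matrix (Fin d) (Fin d) ℝ)).transpose =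
      -Matrix.fromBlocks 0 1 (-1) 0 := by
    simp [Matrix.fromBlocks_transpose, Matrix.fromBlocks_neg]
  rw [J, inner_act_left, h, act_neg, inner_neg_right]

lemma inner_J_J (x y : PhaseSpace d) : inner ℝ (J d x) (J d y) = inner ℝ x y := by
  rw [inner_J_left, J_J, inner_neg_right, neg_neg]

lemma J_injective : Function.Injective (J d) := by
  intro x y h
  have := congrArg (J d) h
  rwa [J_J, J_J, neg_inj] at this

lemma M_M_inv (g : GL (Fin d) ℝ) (x : PhaseSpace d) : M g (M g⁻¹ x) = x := by
  rw [M, M, act_act, Matrix.fromBlocks_multiply]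
  simp [← Matrix.transpose_mul, ← Units.val_mul, -Matrix.coe_units_inv]

lemma M_inv_M (g : GL (Fin d) ℝ) (x : PhaseSpace d) : M g⁻¹ (M g x) = x := by
  simpa using M_M_inv g⁻¹ x

/-- `M(g)` is symplectic. -/
lemma inner_M_inv_J (g : GL (Fin d) ℝ) (x y : PhaseSpace d) :
    inner ℝ (M g⁻¹ x) (J d y) = inner ℝ x (J d (M g y)) := by
  rw [M, J, M, inner_act_left, act_act, act_act]
  congr 3
  simp [Matrix.fromBlocks_transpose, Matrix.fromBlocks_multiply, -Matrix.coe_units_inv]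

end Linear

/-! ### The Hamiltonian flow: smoothness, energy, linearization, symplecticity, completeness. -/

section Flow

variable {H : PhaseSpace d → ℝ}

lemma contDiff_gradient (hH : ContDiff ℝ ∞ H) : ContDiff ℝ ∞ (gradient H) :=
  (InnerProductSpace.toDual ℝ (PhaseSpace d)).symm.contDiff.comp (hH.fderiv_right (by simp))

lemma contDiff_hamField (hH : ContDiff ℝ ∞ H) : ContDiff ℝ ∞ (hamField H) :=
  (J d).contDiff.comp (contDiff_gradient hH)

lemma inner_gradient (z a : PhaseSpace d) : inner ℝ (gradient H z) a = fderiv ℝ H z a := by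
  simp [gradient]

lemma eqOn_of_isTrajectory (hH : ContDiff ℝ ∞ H) {t t' : ℝ} {z : PhaseSpace d}
    {γ γ' : ℝ → PhaseSpace d} (h : IsTrajectory H t z γ) (h' : IsTrajectory H t' z γ')
    (ht : t' ∈ uIcc 0 t) : γ' t' = γ t' :=
  eqOn_of_isIntegralCurveOn ((contDiff_hamField hH).of_le (by simp)) h'.2
    (h.2.mono (uIcc_subset_uIcc_left ht)) (h'.1.trans h.1.symm) right_mem_uIcc

lemma IsTrajectory.mono {t t' : ℝ} {z : PhaseSpace d} {γ : ℝ → PhaseSpace d}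
    (h : IsTrajectory H t z γ) (ht : t' ∈ uIcc 0 t) : IsTrajectory H t' z γ :=
  ⟨h.1, h.2.mono (uIcc_subset_uIcc_left ht)⟩

lemma IsTrajectory.flow_eq (hH : ContDiff ℝ ∞ H) {t t' : ℝ} {z : PhaseSpace d}
    {γ : ℝ → PhaseSpace d} (h : IsTrajectory H t z γ) (ht : t' ∈ uIcc 0 t) :
    flow H t' z = γ t' := by
  have hex : ∃ γ : ℝ → PhaseSpace d, IsTrajectory H t' z γ := ⟨γ, h.mono ht⟩
  rw [flow, dif_pos hex]
  exact eqOn_of_isTrajectory hH h hex.choose_spec ht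

lemma mem_flowDomain_of_mem_uIcc {t t' : ℝ} {z : PhaseSpace d} (h : (t, z) ∈ flowDomain H)
    (ht : t' ∈ uIcc 0 t) : (t', z) ∈ flowDomain H := by
  obtain ⟨γ, hγ⟩ := h
  exact ⟨γ, hγ.mono ht⟩

lemma isTrajectory_zero (z : PhaseSpace d) : IsTrajectory H 0 z fun _ => z := by
  refine ⟨rfl, fun s _ => ?_⟩
  rw [uIcc_self]
  exact HasFDerivWithinAt.of_subsingleton subsingleton_singleton

lemma zero_mem_flowDomain (z : PhaseSpace d) : ((0 : ℝ), z) ∈ flowDomain H :=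
  ⟨_, isTrajectory_zero z⟩

lemma flow_zero (hH : ContDiff ℝ ∞ H) (z : PhaseSpace d) : flow H 0 z = z :=
  (isTrajectory_zero z).flow_eq hH left_mem_uIcc

theorem isOpen_flowDomain (hH : ContDiff ℝ ∞ H) : IsOpen (flowDomain H) := by
  rw [isOpen_iff_mem_nhds]
  rintro ⟨t, z⟩ ⟨γ, rfl, hγ⟩
  obtain ⟨Φ, -, hev⟩ := exists_contDiffAt_flow (contDiff_hamField hH) hγ
  filter_upwards [hev] with x ⟨γ', h0, h1, _⟩
  exact ⟨γ', h0, h1⟩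

theorem contDiffAt_flow (hH : ContDiff ℝ ∞ H) {x : ℝ × PhaseSpace d} (hx : x ∈ flowDomain H) :
    ContDiffAt ℝ ∞ (fun x : ℝ × PhaseSpace d => flow H x.1 x.2) x := by
  obtain ⟨t, z⟩ := x
  obtain ⟨γ, rfl, hγ⟩ := hx
  obtain ⟨Φ, hΦ, hev⟩ := exists_contDiffAt_flow (contDiff_hamField hH) hγ
  refine hΦ.congr_of_eventuallyEq ?_
  filter_upwards [hev] with x ⟨γ', h0, h1, h2⟩
  rw [← h2]
  exact IsTrajectory.flow_eq hH ⟨h0, h1⟩ right_mem_uIcc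

/-- The integral of a smooth function along the flow is smooth. -/
theorem contDiffAt_integral_flow (hH : ContDiff ℝ ∞ H) {f : PhaseSpace d × PhaseSpace d → ℝ}
    (hf : ContDiff ℝ ∞ f) {x : ℝ × PhaseSpace d} (hx : x ∈ flowDomain H) :
    ContDiffAt ℝ ∞ (fun x : ℝ × PhaseSpace d => ∫ s in (0 : ℝ)..x.1, f (flow H s x.2, x.2)) x := by
  obtain ⟨t, z⟩ := x
  obtain ⟨γ, rfl, hγ⟩ := hx
  obtain ⟨Φ, hΦ, hev⟩ := exists_contDiffAt_integral (contDiff_hamField hH) hf hγ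
  refine hΦ.congr_of_eventuallyEq ?_
  filter_upwards [hev] with x ⟨γ', h0, h1, h2⟩
  rw [← h2]
  refine intervalIntegral.integral_congr fun s hs => ?_
  have hfl : flow H s x.2 = γ' s := IsTrajectory.flow_eq hH ⟨h0, h1⟩ hs
  simp only [hfl]

/-- At `t = 0` the interval from `0` to `t` is a point and determines no derivative. Openness of the
domain supplies a nondegenerate interval. -/
lemma exists_ne_zero_mem_flowDomain (hH : ContDiff ℝ ∞ H) {t : ℝ} {z : PhaseSpace d}
    (h : (t, z) ∈ flowDomain H) : ∃ t' ≠ 0, t ∈ uIcc 0 t' ∧ (t', z) ∈ flowDomain H := by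
  rcases eq_or_ne t 0 with rfl | ht
  · have hc : Continuous fun s : ℝ => (s, z) := by fun_prop
    have h1 : ∀ᶠ s in 𝓝 (0 : ℝ), (s, z) ∈ flowDomain H :=
      hc.continuousAt.eventually_mem ((isOpen_flowDomain hH).mem_nhds h)
    obtain ⟨s, hs, hs0⟩ := ((h1.filter_mono nhdsWithin_le_nhds).and
      (self_mem_nhdsWithin (s := {(0 : ℝ)}ᶜ))).exists
    exact ⟨s, hs0, left_mem_uIcc, hs⟩
  · exact ⟨t, ht, right_mem_uIcc, h⟩

/-- Joint smoothness already gives two-sided differentiability; its value is read off from the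
one-sided equation on a nondegenerate interval containing `t`. -/
theorem hasDerivAt_flow (hH : ContDiff ℝ ∞ H) {t : ℝ} {z : PhaseSpace d}
    (h : (t, z) ∈ flowDomain H) :
    HasDerivAt (fun s => flow H s z) (hamField H (flow H t z)) t := by
  have hd : DifferentiableAt ℝ (fun s => flow H s z) t :=
    DifferentiableAt.comp (g := fun x : ℝ × PhaseSpace d => flow H x.1 x.2) (f := fun s => (s, z)) t
      ((contDiffAt_flow hH h).differentiableAt (by simp)) (by fun_prop)
  obtain ⟨t', ht', htt', γ, hγ⟩ := exists_ne_zero_mem_flowDomain hH h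
  have h1 : HasDerivWithinAt (fun s => flow H s z) (hamField H (flow H t z)) (uIcc 0 t') t := by
    rw [hγ.flow_eq hH htt']
    exact (hγ.2 t htt').congr (fun s hs => hγ.flow_eq hH hs) (hγ.flow_eq hH htt')
  have huniq : UniqueDiffWithinAt ℝ (uIcc 0 t') t :=
    uniqueDiffOn_Icc (by simpa using ht') t htt'
  have h2 := huniq.eq_deriv _ h1 hd.hasDerivAt.hasDerivWithinAt
  rw [h2]
  exact hd.hasDerivAt

lemma eq_of_hasDerivAt_zero {F : Type*} [NormedAddCommGroup F] [NormedSpace ℝ F] {f : ℝ → F}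
    {t : ℝ} (h : ∀ s ∈ uIcc 0 t, HasDerivAt f 0 s) : f t = f 0 := by
  have := (convex_uIcc (0 : ℝ) t).norm_image_sub_le_of_norm_hasDerivWithin_le (C := 0)
    (fun s hs => (h s hs).hasDerivWithinAt) (by simp) left_mem_uIcc right_mem_uIcc
  simpa [sub_eq_zero] using this

/-- Conservation of energy. -/
theorem energy_flow (hH : ContDiff ℝ ∞ H) {t : ℝ} {z : PhaseSpace d} (h : (t, z) ∈ flowDomain H) :
    H (flow H t z) = H z := by
  have := eq_of_hasDerivAt_zero (f := fun s => H (flow H s z)) (t := t) fun s hs => by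
    have h1 := ((hH.differentiable (by simp) (flow H s z)).hasFDerivAt).comp_hasDerivAt s
      (hasDerivAt_flow hH (mem_flowDomain_of_mem_uIcc h hs))
    refine h1.congr_deriv ?_
    rw [← inner_gradient, hamField]
    -- Antisymmetry of `J` makes this pairing its own negative.
    have := inner_J_left (gradient H (flow H s z)) (gradient H (flow H s z))
    rw [real_inner_comm] at this
    linarith
  simpa [flow_zero hH] using this

lemma hasFDerivAt_flow (hH : ContDiff ℝ ∞ H) {t : ℝ} {z : PhaseSpace d}
    (h : (t, z) ∈ flowDomain H) : HasFDerivAt (flow H t) (monodromy H t z) z := by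
  have hd : DifferentiableAt ℝ (flow H t) z :=
    DifferentiableAt.comp (g := fun x : ℝ × PhaseSpace d => flow H x.1 x.2) (f := fun w => (t, w)) z
      ((contDiffAt_flow hH h).differentiableAt (by simp)) (by fun_prop)
  exact hd.hasFDerivAt

lemma fderiv_uncurry_flow (hH : ContDiff ℝ ∞ H) {x : ℝ × PhaseSpace d}
    (h : x ∈ flowDomain H) (v : ℝ × PhaseSpace d) :
    fderiv ℝ (fun x : ℝ × PhaseSpace d => flow H x.1 x.2) x v =
      v.1 • hamField H (flow H x.1 x.2) + monodromy H x.1 x.2 v.2 := by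
  obtain ⟨t, z⟩ := x
  have hd := ((contDiffAt_flow hH h).differentiableAt (by simp)).hasFDerivAt
  have h1 := HasFDerivAt.comp_hasDerivAt (f := fun s => (s, z)) t hd
    ((hasDerivAt_id t).prodMk (hasDerivAt_const t z))
  have h2 := HasFDerivAt.comp (f := fun w => (t, w)) z hd (hasFDerivAt_prodMk_right (𝕜 := ℝ) t z)
  have e1 := h1.unique (hasDerivAt_flow hH h)
  have e2 := h2.unique (hasFDerivAt_flow hH h)
  have hv : v = v.1 • ((1 : ℝ), (0 : PhaseSpace d)) + (0, v.2) := by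
    ext <;> simp
  conv_lhs => rw [hv]
  rw [map_add, map_smul, e1, ← e2]
  rfl

lemma monodromy_eq_fderiv (hH : ContDiff ℝ ∞ H) {x : ℝ × PhaseSpace d}
    (h : x ∈ flowDomain H) (a : PhaseSpace d) :
    monodromy H x.1 x.2 a = fderiv ℝ (fun x : ℝ × PhaseSpace d => flow H x.1 x.2) x (0, a) := by
  simp [fderiv_uncurry_flow hH h]

lemma contDiffAt_fderiv_flow (hH : ContDiff ℝ ∞ H) {x : ℝ × PhaseSpace d}
    (h : x ∈ flowDomain H) :
    ContDiffAt ℝ ∞ (fderiv ℝ fun x : ℝ × PhaseSpace d => flow H x.1 x.2) x :=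
  (contDiffAt_flow hH h).fderiv_right (by simp)

lemma contDiffAt_monodromy (hH : ContDiff ℝ ∞ H) {x : ℝ × PhaseSpace d}
    (h : x ∈ flowDomain H) (a : PhaseSpace d) :
    ContDiffAt ℝ ∞ (fun x : ℝ × PhaseSpace d => monodromy H x.1 x.2 a) x := by
  refine ((contDiffAt_fderiv_flow hH h).clm_apply
    (contDiffAt_const (c := (0, a)))).congr_of_eventuallyEq ?_
  filter_upwards [(isOpen_flowDomain hH).mem_nhds h] with y hy
  exact monodromy_eq_fderiv hH hy a

/-- Symmetry of the second derivative, for a function differentiated along `v` and then `w`. -/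
lemma fderiv_fderiv_apply_comm {V F : Type*} [NormedAddCommGroup V] [NormedSpace ℝ V]
    [NormedAddCommGroup F] [NormedSpace ℝ F] {f : V → F} {x : V} (hf : ContDiffAt ℝ ∞ f x)
    (v w : V) :
    fderiv ℝ (fun y => fderiv ℝ f y v) x w = fderiv ℝ (fun y => fderiv ℝ f y w) x v := by
  have hd : DifferentiableAt ℝ (fderiv ℝ f) x :=
    ContDiffAt.differentiableAt (n := ∞) (hf.fderiv_right (by simp)) (by simp)
  rw [fderiv_clm_apply hd (by fun_prop), fderiv_clm_apply hd (by fun_prop)]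
  simpa using hf.isSymmSndFDerivAt (by simp; exact WithTop.coe_le_coe.2 le_top) w v

/-- The linearized equation. -/
theorem hasDerivAt_monodromy (hH : ContDiff ℝ ∞ H) {t : ℝ} {z : PhaseSpace d}
    (h : (t, z) ∈ flowDomain H) (a : PhaseSpace d) :
    HasDerivAt (fun s => monodromy H s z a)
      (fderiv ℝ (hamField H) (flow H t z) (monodromy H t z a)) t := by
  have hd := ((contDiffAt_monodromy hH h a).differentiableAt (by simp)).hasFDerivAt
  have h1 := HasFDerivAt.comp_hasDerivAt (f := fun s => (s, z)) t hd
    ((hasDerivAt_id t).prodMk (hasDerivAt_const t z))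
  refine h1.congr_deriv ?_
  have hnhds := (isOpen_flowDomain hH).mem_nhds h
  have e1 : (fun x : ℝ × PhaseSpace d => monodromy H x.1 x.2 a) =ᶠ[𝓝 (t, z)]
      fun y => fderiv ℝ (fun x : ℝ × PhaseSpace d => flow H x.1 x.2) y (0, a) := by
    filter_upwards [hnhds] with y hy using monodromy_eq_fderiv hH hy a
  have e2 : (fun y => fderiv ℝ (fun x : ℝ × PhaseSpace d => flow H x.1 x.2) y (1, 0))
      =ᶠ[𝓝 (t, z)] fun y => hamField H (flow H y.1 y.2) := by
    filter_upwards [hnhds] with y hy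
    simp [fderiv_uncurry_flow hH hy]
  -- The time and space derivatives are exchanged, and the time derivative of the flow is replaced
  -- by the field along it.
  rw [e1.fderiv_eq, fderiv_fderiv_apply_comm (contDiffAt_flow hH h), e2.fderiv_eq]
  have h3 := HasFDerivAt.comp (g := hamField H) (t, z)
    ((contDiff_hamField hH).differentiable (by simp) (flow H t z)).hasFDerivAt
    ((contDiffAt_flow hH h).differentiableAt (by simp)).hasFDerivAt
  have h4 := h3.fderiv
  simp only [Function.comp_def] at h4
  rw [h4, ContinuousLinearMap.comp_apply, ← monodromy_eq_fderiv hH h]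

lemma fderiv_hamField (hH : ContDiff ℝ ∞ H) (z a : PhaseSpace d) :
    fderiv ℝ (hamField H) z a = J d (fderiv ℝ (gradient H) z a) := by
  have := (J d).hasFDerivAt.comp z
    ((contDiff_gradient hH).differentiable (by simp) z).hasFDerivAt
  exact congrArg (fun L => L a) this.fderiv

lemma inner_fderiv_gradient_comm (hH : ContDiff ℝ ∞ H) (z a b : PhaseSpace d) :
    inner ℝ (fderiv ℝ (gradient H) z a) b = inner ℝ a (fderiv ℝ (gradient H) z b) := by
  have key : ∀ a b : PhaseSpace d,
      inner ℝ (fderiv ℝ (gradient H) z a) b = fderiv ℝ (fun y => fderiv ℝ H y b) z a := by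
    intro a b
    have h1 := ((contDiff_gradient hH).differentiable (by simp) z).hasFDerivAt.inner ℝ
      (hasFDerivAt_const b z)
    simp only [inner_gradient] at h1
    rw [h1.fderiv]
    simp
  rw [key, real_inner_comm, key, fderiv_fderiv_apply_comm hH.contDiffAt]

lemma monodromy_zero (hH : ContDiff ℝ ∞ H) (z a : PhaseSpace d) : monodromy H 0 z a = a := by
  have : flow H 0 = id := funext (flow_zero hH)
  simp [monodromy, this]

/-- The flow is symplectic. -/
theorem inner_monodromy_J_monodromy (hH : ContDiff ℝ ∞ H) {t : ℝ} {z : PhaseSpace d}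
    (h : (t, z) ∈ flowDomain H) (a b : PhaseSpace d) :
    inner ℝ (monodromy H t z a) (J d (monodromy H t z b)) = inner ℝ a (J d b) := by
  have := eq_of_hasDerivAt_zero (t := t)
    (f := fun s => inner ℝ (monodromy H s z a) (J d (monodromy H s z b))) fun s hs => by
    have hs' := mem_flowDomain_of_mem_uIcc h hs
    have h1 := (hasDerivAt_monodromy hH hs' a).inner ℝ
      ((J d).hasFDerivAt.comp_hasDerivAt s (hasDerivAt_monodromy hH hs' b))
    refine h1.congr_deriv ?_
    -- With S the Hessian of `H`, the derivative is −⟨Fa, S Fb⟩ + ⟨S Fa, Fb⟩, which vanishes because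
    -- S is symmetric.
    rw [Function.comp_apply, fderiv_hamField hH, fderiv_hamField hH, J_J, inner_J_J, inner_neg_right,
      inner_fderiv_gradient_comm hH]
    simp
  simpa [monodromy_zero hH] using this

/-- Conservation of energy holds for all initial points near `z`, so it can be differentiated in
`z`. -/
lemma inner_gradient_flow_monodromy (hH : ContDiff ℝ ∞ H) {t : ℝ} {z : PhaseSpace d}
    (h : (t, z) ∈ flowDomain H) (a : PhaseSpace d) :
    inner ℝ (gradient H (flow H t z)) (monodromy H t z a) = inner ℝ (gradient H z) a := by
  have h1 := (hH.differentiable (by simp) (flow H t z)).hasFDerivAt.comp z (hasFDerivAt_flow hH h)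
  have h2 : (H ∘ flow H t) =ᶠ[𝓝 z] H := by
    have hc : Continuous fun w : PhaseSpace d => (t, w) := by fun_prop
    filter_upwards [hc.continuousAt.eventually_mem ((isOpen_flowDomain hH).mem_nhds h)] with w hw
    exact energy_flow hH hw
  have h3 := h1.congr_of_eventuallyEq h2.symm
  rw [inner_gradient, inner_gradient, h3.fderiv]
  rfl

/-- Completeness of the flow under the growth condition: multiplying the field by a function of the
energy makes it bounded and does not change the trajectory of a given point. -/
theorem flowDomain_eq_univ (hH : ContDiff ℝ ∞ H)
    (hC : ∃ C : ℝ, ∀ z, ‖gradient H z‖ ≤ C * (1 + |H z|)) : flowDomain H = univ := by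
  obtain ⟨C, hC⟩ := hC
  refine eq_univ_of_forall fun ⟨t, z⟩ => ?_
  -- This factor equals 1 on the energy level of `z` and decays fast enough in `H` to absorb the
  -- growth `1 + |H|`; the square keeps it smooth.
  set ρ : PhaseSpace d → ℝ := fun w => (1 + (H w - H z) ^ 2)⁻¹ with hρ
  have hpos : ∀ w, 0 < 1 + (H w - H z) ^ 2 := fun w => by positivity
  have hρs : ContDiff ℝ ∞ ρ :=
    ContDiff.inv (contDiff_const.add ((hH.sub contDiff_const).pow 2)) fun w => (hpos w).ne'
  have hY : ContDiff ℝ ∞ fun w => ρ w • hamField H w := hρs.smul (contDiff_hamField hH)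
  have hJ : ∀ w : PhaseSpace d, ‖J d w‖ = ‖w‖ := fun w => by
    rw [← sq_eq_sq₀ (norm_nonneg _) (norm_nonneg _), ← real_inner_self_eq_norm_sq,
      ← real_inner_self_eq_norm_sq, inner_J_J]
  have hb : ∀ w, ‖ρ w • hamField H w‖ ≤ |C| * (2 + |H z|) := by
    intro w
    rw [norm_smul, Real.norm_eq_abs, abs_of_pos (inv_pos.2 (hpos w)), hamField, hJ,
      inv_mul_le_iff₀ (hpos w)]
    have h1 : |H w| ≤ |H w - H z| + |H z| := by
      simpa using abs_add_le (H w - H z) (H z)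
    have h2 : ‖gradient H w‖ ≤ |C| * (1 + |H w|) :=
      (hC w).trans (mul_le_mul_of_nonneg_right (le_abs_self C) (by positivity))
    have h3 : 1 + |H w| ≤ (1 + (H w - H z) ^ 2) * (2 + |H z|) := by
      rw [← sq_abs (H w - H z)]
      nlinarith [abs_nonneg (H w - H z), abs_nonneg (H z), sq_nonneg (|H w - H z| - 1),
        mul_nonneg (sq_nonneg |H w - H z|) (abs_nonneg (H z))]
    calc ‖gradient H w‖ ≤ |C| * (1 + |H w|) := h2
      _ ≤ |C| * ((1 + (H w - H z) ^ 2) * (2 + |H z|)) := by gcongr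
      _ = _ := by ring
  obtain ⟨γ, h0, hγ⟩ := exists_isIntegralCurveOn_of_bounded (hY.of_le (by simp)) hb t z
  -- The slowed field is still parallel to `J ∇H`, so it conserves energy and `ρ = 1` along `γ`.
  have hE : ∀ s ∈ uIcc 0 t, H (γ s) = H z := by
    intro s hs
    have h1 : ∀ r ∈ uIcc 0 t, HasDerivWithinAt (fun r => H (γ r)) 0 (uIcc 0 t) r := by
      intro r hr
      have h2 := ((hH.differentiable (by simp) (γ r)).hasFDerivAt).comp_hasDerivWithinAt r (hγ r hr)
      refine h2.congr_deriv ?_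
      rw [← inner_gradient, inner_smul_right, hamField]
      have := inner_J_left (gradient H (γ r)) (gradient H (γ r))
      rw [real_inner_comm] at this
      have h3 : inner ℝ (gradient H (γ r)) (J d (gradient H (γ r))) = 0 := by linarith
      rw [h3, mul_zero]
    have h4 := (convex_uIcc (0 : ℝ) t).norm_image_sub_le_of_norm_hasDerivWithin_le (C := 0)
      h1 (by simp) left_mem_uIcc hs
    simpa [sub_eq_zero, h0] using h4
  refine ⟨γ, h0, fun s hs => ?_⟩
  have := hγ s hs
  simpa [hρ, hE s hs] using this

end Flow

end ReducedPhase

end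

noncomputable section

namespace ReducedPhase

open Set Filter Topology Matrix

/-! ### Matrices with positive imaginary part and their Cayley transforms. -/

section SiegelUpperHalfSpace

variable {n : Type*} [Fintype n]

lemma re_star_dotProduct_self_eq_sum (v : n → ℂ) :
    (star v ⬝ᵥ v).re = ∑ i, Complex.normSq (v i) := by
  simp [dotProduct, Complex.normSq_apply]

lemma re_star_dotProduct_self_pos {v : n → ℂ} (hv : v ≠ 0) : 0 < (star v ⬝ᵥ v).re := by
  rw [re_star_dotProduct_self_eq_sum]
  obtain ⟨i, hi⟩ := Function.ne_iff.1 hv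
  exact Finset.sum_pos' (fun i _ => Complex.normSq_nonneg _)
    ⟨i, Finset.mem_univ _, Complex.normSq_pos.2 hi⟩

/-- The pairing is bilinear, so the inequality is |aᵢ − conj bᵢ|² ≥ 0 summed over `i`. -/
lemma re_dotProduct_le (a b : n → ℂ) :
    (a ⬝ᵥ b).re ≤ ((star a ⬝ᵥ a).re + (star b ⬝ᵥ b).re) / 2 := by
  rw [re_star_dotProduct_self_eq_sum, re_star_dotProduct_self_eq_sum, ← Finset.sum_add_distrib,
    Finset.sum_div, dotProduct, Complex.re_sum]
  refine Finset.sum_le_sum fun i _ => ?_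
  rw [Complex.mul_re, Complex.normSq_apply, Complex.normSq_apply]
  nlinarith [sq_nonneg ((a i).re - (b i).re), sq_nonneg ((a i).im + (b i).im)]

variable [DecidableEq n]

/-- For a real symplectic matrix `(A B; C D)`, the form `Im ⟨(A + iB)v, (C + iD)v⟩` is `|v|²`. -/
lemma im_star_dotProduct_of_symplectic {A B C D : Matrix n n ℂ} (hA : Aᴴ = Aᵀ) (hB : Bᴴ = Bᵀ)
    (hC : Cᴴ = Cᵀ) (hD : Dᴴ = Dᵀ) (hAC : Aᵀ * C = Cᵀ * A) (hBD : Bᵀ * D = Dᵀ * B)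
    (hAD : Aᵀ * D - Cᵀ * B = 1) (v : n → ℂ) :
    (star ((A + Complex.I • B) *ᵥ v) ⬝ᵥ ((C + Complex.I • D) *ᵥ v)).im = (star v ⬝ᵥ v).re := by
  set P : Matrix n n ℂ := (A + Complex.I • B)ᴴ * (C + Complex.I • D) with hP
  have h1 : star ((A + Complex.I • B) *ᵥ v) ⬝ᵥ ((C + Complex.I • D) *ᵥ v)
      = star v ⬝ᵥ (P *ᵥ v) := by
    rw [star_mulVec, hP, ← mulVec_mulVec, dotProduct_mulVec (star v)]
  have hDA : Dᵀ * A - Bᵀ * C = 1 := by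
    simpa [transpose_sub, transpose_mul] using congrArg transpose hAD
  -- The symplectic block relations cancel everything in the anti-Hermitian part of `P` except the
  -- scalar `i`.
  have hPP : P - Pᴴ = (2 * Complex.I) • (1 : Matrix n n ℂ) := by
    have h2 : P - Pᴴ = (Aᵀ * C - Cᵀ * A) + (Bᵀ * D - Dᵀ * B)
        + Complex.I • ((Aᵀ * D - Cᵀ * B) + (Dᵀ * A - Bᵀ * C)) := by
      have e1 : P = (Aᵀ - Complex.I • Bᵀ) * (C + Complex.I • D) := by
        rw [hP, conjTranspose_add, conjTranspose_smul, hA, hB, Complex.star_def, Complex.conj_I,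
          neg_smul, sub_eq_add_neg]
      have e2 : Pᴴ = (Cᵀ - Complex.I • Dᵀ) * (A + Complex.I • B) := by
        rw [hP, conjTranspose_mul, conjTranspose_conjTranspose, conjTranspose_add,
          conjTranspose_smul, hC, hD, Complex.star_def, Complex.conj_I, neg_smul, sub_eq_add_neg]
      rw [e2, e1]
      simp only [sub_mul, mul_add, smul_mul_assoc, mul_smul_comm, smul_smul, smul_add, smul_sub,
        Complex.I_mul_I, neg_smul, one_smul]
      abel
    rw [h2, hAC, hBD, hAD, hDA, sub_self, sub_self, zero_add, zero_add, ← two_smul ℂ, smul_smul,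
      mul_comm]
  have h3 : star (star v ⬝ᵥ (P *ᵥ v)) = star v ⬝ᵥ (Pᴴ *ᵥ v) := by
    rw [← star_dotProduct_star, star_star, star_mulVec, dotProduct_mulVec (star v)]
  have h4 : star v ⬝ᵥ (P *ᵥ v) - star (star v ⬝ᵥ (P *ᵥ v)) = (2 * Complex.I) * (star v ⬝ᵥ v) := by
    rw [h3, ← dotProduct_sub, ← sub_mulVec, hPP, smul_mulVec, one_mulVec, dotProduct_smul,
      smul_eq_mul]
  have h5 := congrArg Complex.im h4
  simp at h5
  rw [h1]
  linarith

/-- The quotient `(C + iD)(A + iB)⁻¹` has positive imaginary part. -/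
lemma det_ne_zero_and_im_pos_of_symplectic {P Q : Matrix n n ℂ}
    (h : ∀ v, (star (P *ᵥ v) ⬝ᵥ (Q *ᵥ v)).im = (star v ⬝ᵥ v).re) :
    P.det ≠ 0 ∧ ∀ u ≠ 0, 0 < (star u ⬝ᵥ ((Q * P⁻¹) *ᵥ u)).im := by
  have hdet : P.det ≠ 0 := by
    intro h0
    obtain ⟨v, hv, hPv⟩ := exists_mulVec_eq_zero_iff.2 h0
    have h1 := h v
    rw [hPv] at h1
    have h2 := re_star_dotProduct_self_pos hv
    simp at h1
    simp [← h1] at h2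
  refine ⟨hdet, fun u hu => ?_⟩
  have hu' : P *ᵥ (P⁻¹ *ᵥ u) = u := by
    rw [mulVec_mulVec, mul_nonsing_inv _ (isUnit_iff_ne_zero.2 hdet), one_mulVec]
  have h1 := h (P⁻¹ *ᵥ u)
  rw [hu', mulVec_mulVec] at h1
  rw [h1]
  refine re_star_dotProduct_self_pos fun h0 => hu ?_
  rw [← hu', h0, mulVec_zero]

lemma im_pos_congruence {Z k : Matrix n n ℂ} (hk : kᴴ = kᵀ) (hdet : k.det ≠ 0)
    (hZ : ∀ u ≠ 0, 0 < (star u ⬝ᵥ (Z *ᵥ u)).im) :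
    ∀ u ≠ 0, 0 < (star u ⬝ᵥ ((kᵀ * Z * k) *ᵥ u)).im := by
  intro u hu
  have h1 : star u ⬝ᵥ ((kᵀ * Z * k) *ᵥ u) = star (k *ᵥ u) ⬝ᵥ (Z *ᵥ (k *ᵥ u)) := by
    rw [star_mulVec, hk, ← mulVec_mulVec, ← mulVec_mulVec, dotProduct_mulVec]
  rw [h1]
  exact hZ _ fun h0 => hdet (exists_mulVec_eq_zero_iff.1 ⟨u, hu, h0⟩)

/-- The real part of ⟨v, (1 − iZ)v⟩ is |v|² + Im⟨v, Zv⟩, positive for `v ≠ 0`. -/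
lemma det_one_sub_ne_zero_of_im_pos {Z : Matrix n n ℂ}
    (hZ : ∀ u ≠ 0, 0 < (star u ⬝ᵥ (Z *ᵥ u)).im) : (1 - Complex.I • Z).det ≠ 0 := by
  intro h0
  obtain ⟨v, hv, hv0⟩ := exists_mulVec_eq_zero_iff.2 h0
  have h1 : star v ⬝ᵥ ((1 - Complex.I • Z) *ᵥ v)
      = star v ⬝ᵥ v - Complex.I * (star v ⬝ᵥ (Z *ᵥ v)) := by
    rw [sub_mulVec, one_mulVec, smul_mulVec, dotProduct_sub, dotProduct_smul, smul_eq_mul]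
  rw [hv0, dotProduct_zero] at h1
  have h2 := congrArg Complex.re h1
  simp only [Complex.zero_re, Complex.sub_re, Complex.mul_re, Complex.I_re, Complex.I_im,
    zero_mul, one_mul, zero_sub] at h2
  linarith [hZ v hv, re_star_dotProduct_self_pos hv]

/-- The Cayley transform of a matrix with positive imaginary part is a strict contraction. -/
lemma re_cayley_dotProduct_lt {Z : Matrix n n ℂ} (hZ : ∀ u ≠ 0, 0 < (star u ⬝ᵥ (Z *ᵥ u)).im)
    {η : n → ℂ} (hη : η ≠ 0) :
    ((((2 : ℂ) • (1 - Complex.I • Z)⁻¹ - 1) *ᵥ η) ⬝ᵥ η).re < (star η ⬝ᵥ η).re := by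
  have hdet := det_one_sub_ne_zero_of_im_pos hZ
  -- In terms of `u`, η = (1 − iZ)u and Wη = (1 + iZ)u, so |η|² − |Wη|² = 4 Im⟨u, Zu⟩ > 0.
  set u := (1 - Complex.I • Z)⁻¹ *ᵥ η with hu
  have hη' : η = u - Complex.I • (Z *ᵥ u) := by
    have : (1 - Complex.I • Z) *ᵥ u = η := by
      rw [hu, mulVec_mulVec, mul_nonsing_inv _ (isUnit_iff_ne_zero.2 hdet), one_mulVec]
    rw [← this, sub_mulVec, one_mulVec, smul_mulVec]
  have hu0 : u ≠ 0 := by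
    intro h0
    rw [h0, mulVec_zero, smul_zero, sub_zero] at hη'
    exact hη hη'
  have hW : ((2 : ℂ) • (1 - Complex.I • Z)⁻¹ - 1) *ᵥ η = u + Complex.I • (Z *ᵥ u) := by
    rw [sub_mulVec, one_mulVec, smul_mulVec, ← hu]
    conv_lhs => rw [hη']
    rw [two_smul]
    abel
  rw [hW]
  have hkey : (star η ⬝ᵥ η).re - (star (u + Complex.I • (Z *ᵥ u)) ⬝ᵥ (u + Complex.I • (Z *ᵥ u))).re
      = 4 * (star u ⬝ᵥ (Z *ᵥ u)).im := by
    rw [hη', re_star_dotProduct_self_eq_sum, re_star_dotProduct_self_eq_sum,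
      ← Finset.sum_sub_distrib, dotProduct, Complex.im_sum, Finset.mul_sum]
    refine Finset.sum_congr rfl fun i _ => ?_
    simp [Complex.normSq_apply]
    ring
  have := re_dotProduct_le (u + Complex.I • (Z *ᵥ u)) η
  linarith [hZ u hu0]

/-- Positivity of the quadratic form `⟨(I - Ŵ)y, y⟩` at real vectors. -/
lemma re_hat_form_pos {w : Matrix n n ℂ}
    (hw : ∀ η : n → ℂ, η ≠ 0 → ((w *ᵥ η) ⬝ᵥ η).re < (star η ⬝ᵥ η).re) {y : n ⊕ n → ℝ} (hy : y ≠ 0) :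
    0 < (((1 - fromBlocks w (-(Complex.I • w)) (-(Complex.I • w)) (-w)) *ᵥ
      fun i => (y i : ℂ)) ⬝ᵥ fun i => (y i : ℂ)).re := by
  set a : n → ℂ := fun i => (y (Sum.inl i) : ℂ) with ha
  set b : n → ℂ := fun i => (y (Sum.inr i) : ℂ) with hb
  -- The block form of Ŵ is chosen so that ⟨Ŵy, y⟩ = ⟨Wη, η⟩, with no symmetry of `w` needed. Since
  -- `a` and `b` are real, |η|² = |y|².
  set η : n → ℂ := a - Complex.I • b with hη
  have hη0 : η ≠ 0 := by
    intro h0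
    apply hy
    funext i
    rcases i with i | i
    · have := congrArg Complex.re (congrFun h0 i)
      simpa [hη, ha, hb] using this
    · have := congrArg Complex.im (congrFun h0 i)
      simpa [hη, ha, hb] using this
  have hyab : (fun i => (y i : ℂ)) = Sum.elim a b := by
    funext i
    rcases i with i | i <;> rfl
  have h1 : ((1 - fromBlocks w (-(Complex.I • w)) (-(Complex.I • w)) (-w)) *ᵥ Sum.elim a b)
      ⬝ᵥ Sum.elim a b = (a ⬝ᵥ a + b ⬝ᵥ b) - (w *ᵥ η) ⬝ᵥ η := by
    rw [sub_mulVec, one_mulVec, sub_dotProduct, sumElim_dotProduct_sumElim, fromBlocks_mulVec,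
      sumElim_dotProduct_sumElim, hη]
    simp only [Sum.elim_comp_inl, Sum.elim_comp_inr, mulVec_sub, mulVec_smul, neg_mulVec,
      smul_mulVec, add_dotProduct, neg_dotProduct, smul_dotProduct, sub_dotProduct,
      dotProduct_sub, dotProduct_smul, smul_eq_mul]
    linear_combination ((w *ᵥ b) ⬝ᵥ b) * Complex.I_mul_I
  have h2 : (a ⬝ᵥ a + b ⬝ᵥ b).re = (star η ⬝ᵥ η).re := by
    rw [re_star_dotProduct_self_eq_sum, dotProduct, dotProduct, ← Finset.sum_add_distrib,
      Complex.re_sum]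
    refine Finset.sum_congr rfl fun i _ => ?_
    simp [hη, ha, hb, Complex.normSq_apply]
  rw [hyab, h1, Complex.sub_re, h2]
  linarith [hw η hη0]

end SiegelUpperHalfSpace

/-! ### Entrywise smoothness of matrix products and inverses. -/

section SmoothInverse

variable {V : Type*} [NormedAddCommGroup V] [NormedSpace ℝ V] {n : Type*} [Fintype n]

lemma contDiffAt_mul_apply {A B : V → Matrix n n ℂ} {x : V}
    (hA : ∀ i j, ContDiffAt ℝ ∞ (fun y => A y i j) x)
    (hB : ∀ i j, ContDiffAt ℝ ∞ (fun y => B y i j) x) (i j : n) :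
    ContDiffAt ℝ ∞ (fun y => (A y * B y) i j) x := by
  simp only [mul_apply]
  exact ContDiffAt.sum fun k _ => (hA i k).mul (hB k j)

variable [DecidableEq n]

lemma contDiffAt_det {A : V → Matrix n n ℂ} {x : V}
    (hA : ∀ i j, ContDiffAt ℝ ∞ (fun y => A y i j) x) : ContDiffAt ℝ ∞ (fun y => (A y).det) x := by
  simp only [det_apply']
  exact ContDiffAt.sum fun σ _ => contDiffAt_const.mul (contDiffAt_prod fun i _ => hA _ _)

/-- Cramer's rule: the entries are cofactors divided by the determinant. -/
lemma contDiffAt_inv_apply {A : V → Matrix n n ℂ} {x : V}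
    (hA : ∀ i j, ContDiffAt ℝ ∞ (fun y => A y i j) x) (hdet : (A x).det ≠ 0) (i j : n) :
    ContDiffAt ℝ ∞ (fun y => (A y)⁻¹ i j) x := by
  simp only [inv_def, Ring.inverse_eq_inv', Matrix.smul_apply, smul_eq_mul, adjugate_apply]
  refine ((contDiffAt_det hA).inv hdet).mul (contDiffAt_det fun k l => ?_)
  simp only [updateRow_apply]
  split_ifs
  · exact contDiffAt_const
  · exact hA k l

end SmoothInverse

/-! ### Positivity and smoothness of the matrices built from `F_z(t)`. -/

variable {d : ℕ} {H : PhaseSpace d → ℝ}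

/-- The real matrix of `F_z(t)`. -/
def realMonodromyMatrix (H : PhaseSpace d → ℝ) (t : ℝ) (z : PhaseSpace d) :
    Matrix (Fin d ⊕ Fin d) (Fin d ⊕ Fin d) ℝ :=
  Matrix.of fun i j => monodromy H t z (EuclideanSpace.single j 1) i

lemma act_realMonodromyMatrix (t : ℝ) (z : PhaseSpace d) :
    act (realMonodromyMatrix H t z) = monodromy H t z := by
  ext a i
  have ha : a = ∑ j, a j • EuclideanSpace.single j (1 : ℝ) := by
    ext k
    simp [Finset.sum_apply, Pi.single_apply, -Fintype.sum_sum_type]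
  conv_rhs => rw [ha]
  simp [act, realMonodromyMatrix, Matrix.mulVec, dotProduct, mul_comm]

lemma act_injective : Function.Injective (act (d := d)) :=
  fun _ _ h => (Matrix.toEuclideanCLM (n := Fin d ⊕ Fin d) (𝕜 := ℝ)).injective h

lemma realMonodromyMatrix_symplectic (hH : ContDiff ℝ ∞ H) {t : ℝ} {z : PhaseSpace d}
    (h : (t, z) ∈ flowDomain H) :
    (realMonodromyMatrix H t z)ᵀ * fromBlocks 0 1 (-1) 0 * realMonodromyMatrix H t z =
      fromBlocks 0 1 (-1) 0 := by
  apply act_injective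
  refine ContinuousLinearMap.ext fun b => ext_inner_left ℝ fun a => ?_
  rw [← act_act, ← act_act, ← inner_act_left, act_realMonodromyMatrix]
  exact inner_monodromy_J_monodromy hH h a b

lemma conjTranspose_map_ofReal (A : Matrix (Fin d) (Fin d) ℝ) :
    (A.map Complex.ofRealHom)ᴴ = (A.map Complex.ofRealHom)ᵀ := by
  ext i j
  simp

/-- The real identity ᵗF J F = J, read block by block and mapped to `ℂ`, yields the three relations
of `im_star_dotProduct_of_symplectic`. -/
lemma monodromyMatrix_im (hH : ContDiff ℝ ∞ H) {t : ℝ} {z : PhaseSpace d}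
    (h : (t, z) ∈ flowDomain H) (v : Fin d → ℂ) :
    (star (((monodromyMatrix H t z).toBlocks₁₁ + Complex.I • (monodromyMatrix H t z).toBlocks₁₂) *ᵥ v)
      ⬝ᵥ (((monodromyMatrix H t z).toBlocks₂₁ +
        Complex.I • (monodromyMatrix H t z).toBlocks₂₂) *ᵥ v)).im = (star v ⬝ᵥ v).re := by
  set R := realMonodromyMatrix H t z with hR
  have h1 := realMonodromyMatrix_symplectic hH h
  rw [← hR, ← fromBlocks_toBlocks R, fromBlocks_transpose, fromBlocks_multiply,
    fromBlocks_multiply, fromBlocks_inj] at h1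
  simp only [mul_zero, mul_neg, mul_one, zero_add, add_zero, neg_mul] at h1
  obtain ⟨e1, e2, -, e4⟩ := h1
  have c1 := congrArg (fun A : Matrix (Fin d) (Fin d) ℝ => A.map Complex.ofRealHom) e1
  have c2 := congrArg (fun A : Matrix (Fin d) (Fin d) ℝ => A.map Complex.ofRealHom) e2
  have c4 := congrArg (fun A : Matrix (Fin d) (Fin d) ℝ => A.map Complex.ofRealHom) e4
  simp only [← RingHom.mapMatrix_apply, map_add, map_neg, map_mul, map_zero, map_one] at c1 c2 c4
  refine im_star_dotProduct_of_symplectic (conjTranspose_map_ofReal R.toBlocks₁₁)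
    (conjTranspose_map_ofReal R.toBlocks₁₂) (conjTranspose_map_ofReal R.toBlocks₂₁)
    (conjTranspose_map_ofReal R.toBlocks₂₂) ?_ ?_ ?_ v
  · exact (neg_add_eq_zero.1 c1).symm
  · exact (neg_add_eq_zero.1 c4).symm
  · rw [← neg_add_eq_sub]
    exact c2

lemma det_block_ne_zero (hH : ContDiff ℝ ∞ H) {t : ℝ} {z : PhaseSpace d}
    (h : (t, z) ∈ flowDomain H) :
    ((monodromyMatrix H t z).toBlocks₁₁ +
      Complex.I • (monodromyMatrix H t z).toBlocks₁₂).det ≠ 0 :=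
  (det_ne_zero_and_im_pos_of_symplectic (monodromyMatrix_im hH h)).1

/-- The real matrix `g⁻¹`, with complex entries. -/
def complexInv (g : GL (Fin d) ℝ) : Matrix (Fin d) (Fin d) ℂ :=
  ((g⁻¹ : GL (Fin d) ℝ) : Matrix (Fin d) (Fin d) ℝ).map (fun x : ℝ => (x : ℂ))

lemma W_eq (g : GL (Fin d) ℝ) (t : ℝ) (z : PhaseSpace d) :
    W H g t z = (2 : ℂ) • (1 - Complex.I • ((complexInv g)ᵀ * M₀ H t z * complexInv g))⁻¹ - 1 := rfl

lemma im_pos_conj_M₀ (hH : ContDiff ℝ ∞ H) (g : GL (Fin d) ℝ) {t : ℝ} {z : PhaseSpace d}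
    (h : (t, z) ∈ flowDomain H) :
    ∀ u ≠ 0, 0 < (star u ⬝ᵥ (((complexInv g)ᵀ * M₀ H t z * complexInv g) *ᵥ u)).im := by
  refine im_pos_congruence (conjTranspose_map_ofReal _) ?_
    (det_ne_zero_and_im_pos_of_symplectic (monodromyMatrix_im hH h)).2
  have h1 : (complexInv g).det = Complex.ofRealHom
      ((g⁻¹ : GL (Fin d) ℝ) : Matrix (Fin d) (Fin d) ℝ).det := by
    rw [RingHom.map_det]
    rfl
  rw [h1]
  exact (map_ne_zero _).2 ((Matrix.isUnit_iff_isUnit_det _).1 (Units.isUnit _)).ne_zero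

lemma re_What_form_pos (hH : ContDiff ℝ ∞ H) (g : GL (Fin d) ℝ) {t : ℝ} {z : PhaseSpace d}
    (h : (t, z) ∈ flowDomain H) {y : Fin d ⊕ Fin d → ℝ} (hy : y ≠ 0) :
    0 < (((1 - What H g t z) *ᵥ fun i => (y i : ℂ)) ⬝ᵥ fun i => (y i : ℂ)).re :=
  re_hat_form_pos (fun η hη => by
    rw [W_eq]
    exact re_cayley_dotProduct_lt (im_pos_conj_M₀ hH g h) hη) hy

lemma contDiffAt_monodromyMatrix (hH : ContDiff ℝ ∞ H) {x : ℝ × PhaseSpace d}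
    (h : x ∈ flowDomain H) (i j : Fin d ⊕ Fin d) :
    ContDiffAt ℝ ∞ (fun y : ℝ × PhaseSpace d => monodromyMatrix H y.1 y.2 i j) x := by
  have h1 := contDiffAt_monodromy hH h (EuclideanSpace.single j 1)
  have h2 : ContDiffAt ℝ ∞ (fun y : ℝ × PhaseSpace d =>
      monodromy H y.1 y.2 (EuclideanSpace.single j 1) i) x :=
    ContDiffAt.continuousLinearMap_comp (EuclideanSpace.proj (𝕜 := ℝ) i) h1
  exact ContDiffAt.continuousLinearMap_comp Complex.ofRealCLM h2

lemma contDiffAt_W (hH : ContDiff ℝ ∞ H) (g : GL (Fin d) ℝ) {x : ℝ × PhaseSpace d}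
    (h : x ∈ flowDomain H) (i j : Fin d) :
    ContDiffAt ℝ ∞ (fun y : ℝ × PhaseSpace d => W H g y.1 y.2 i j) x := by
  have hF := contDiffAt_monodromyMatrix hH h
  have hM : ∀ i j, ContDiffAt ℝ ∞ (fun y : ℝ × PhaseSpace d => M₀ H y.1 y.2 i j) x := by
    refine contDiffAt_mul_apply (fun i j => ?_) (contDiffAt_inv_apply (fun i j => ?_)
      (det_block_ne_zero hH h))
    · exact (hF _ _).add (contDiffAt_const.mul (hF _ _))
    · exact (hF _ _).add (contDiffAt_const.mul (hF _ _))
  have hk : ∀ i j, ContDiffAt ℝ ∞ (fun _ : ℝ × PhaseSpace d => complexInv g i j) x :=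
    fun i j => contDiffAt_const
  have hkt : ∀ i j, ContDiffAt ℝ ∞ (fun _ : ℝ × PhaseSpace d => (complexInv g)ᵀ i j) x :=
    fun i j => contDiffAt_const
  have hZ := contDiffAt_mul_apply (contDiffAt_mul_apply hkt hM) hk
  simp only [W_eq]
  have hinv := contDiffAt_inv_apply
    (A := fun y : ℝ × PhaseSpace d =>
      1 - Complex.I • ((complexInv g)ᵀ * M₀ H y.1 y.2 * complexInv g)) (x := x)
    (fun i j => contDiffAt_const.sub (contDiffAt_const.mul (hZ i j)))
    (det_one_sub_ne_zero_of_im_pos (im_pos_conj_M₀ hH g h))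
  exact (contDiffAt_const.mul (hinv i j)).sub contDiffAt_const

lemma contDiffAt_What (hH : ContDiff ℝ ∞ H) (g : GL (Fin d) ℝ) {x : ℝ × PhaseSpace d}
    (h : x ∈ flowDomain H) (i j : Fin d ⊕ Fin d) :
    ContDiffAt ℝ ∞ (fun y : ℝ × PhaseSpace d => What H g y.1 y.2 i j) x := by
  have hW := contDiffAt_W hH g h
  rcases i with i | i <;> rcases j with j | j
  · exact hW i j
  · exact (contDiffAt_const.mul (hW i j)).neg
  · exact (contDiffAt_const.mul (hW i j)).neg
  · exact (hW i j).neg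

end ReducedPhase

end

noncomputable section

namespace ReducedPhase

open Set Filter Topology

/-! ### Second derivatives of products at common zeros. -/

section SecondDerivative

variable {V : Type*} [NormedAddCommGroup V] [NormedSpace ℝ V]
  {F : Type*} [NormedAddCommGroup F] [NormedSpace ℝ F]

lemma differentiableAt_fderiv_apply {f : V → F} {x : V} (hf : ContDiffAt ℝ ∞ f x) (w : V) :
    DifferentiableAt ℝ (fun y => fderiv ℝ f y w) x :=
  ContDiffAt.differentiableAt (n := ∞)
    (ContDiffAt.clm_apply (hf.fderiv_right (by simp)) contDiffAt_const) (by simp)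

lemma fderiv_fderiv_apply {f : V → F} {x : V} (hf : ContDiffAt ℝ ∞ f x) (v w : V) :
    fderiv ℝ (fderiv ℝ f) x v w = fderiv ℝ (fun y => fderiv ℝ f y w) x v := by
  have hd : DifferentiableAt ℝ (fderiv ℝ f) x :=
    ContDiffAt.differentiableAt (n := ∞) (hf.fderiv_right (by simp)) (by simp)
  rw [fderiv_clm_apply hd (by fun_prop)]
  simp

lemma eventually_differentiableAt {f : V → F} {x : V} (hf : ContDiffAt ℝ ∞ f x) :
    ∀ᶠ y in 𝓝 x, DifferentiableAt ℝ f y := by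
  have h1 : ContDiffAt ℝ 1 f x := hf.of_le (by simp)
  filter_upwards [h1.eventually (by simp)] with y hy
  exact hy.differentiableAt (by simp)

variable {a b c : V → ℂ} {x : V}

lemma fderiv_mul_mul_of_eq_zero (ha : ContDiffAt ℝ ∞ a x) (hb : ContDiffAt ℝ ∞ b x)
    (hc : ContDiffAt ℝ ∞ c x) (ha0 : a x = 0) (hb0 : b x = 0) :
    fderiv ℝ (fun y => c y * (a y * b y)) x = 0 := by
  have h := ((hc.differentiableAt (by simp)).hasFDerivAt).mul
    (((ha.differentiableAt (by simp)).hasFDerivAt).mul ((hb.differentiableAt (by simp)).hasFDerivAt))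
  refine (HasFDerivAt.fderiv h).trans (ContinuousLinearMap.ext fun v => ?_)
  simp [ha0, hb0]

/-- The second derivative of a product at a common zero of two of the factors. -/
lemma fderiv_fderiv_mul_mul_of_eq_zero (ha : ContDiffAt ℝ ∞ a x) (hb : ContDiffAt ℝ ∞ b x)
    (hc : ContDiffAt ℝ ∞ c x) (ha0 : a x = 0) (hb0 : b x = 0) (v w : V) :
    fderiv ℝ (fun y => fderiv ℝ (fun y => c y * (a y * b y)) y w) x v =
      c x * (fderiv ℝ a x v * fderiv ℝ b x w + fderiv ℝ b x v * fderiv ℝ a x w) := by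
  have h1 : (fun y => fderiv ℝ (fun y => c y * (a y * b y)) y w) =ᶠ[𝓝 x] fun y =>
      c y * (a y * fderiv ℝ b y w + b y * fderiv ℝ a y w) + (a y * b y) * fderiv ℝ c y w := by
    filter_upwards [eventually_differentiableAt ha, eventually_differentiableAt hb,
      eventually_differentiableAt hc] with y hay hby hcy
    refine (congrArg (fun L => L w) (HasFDerivAt.fderiv
      (hcy.hasFDerivAt.mul (hay.hasFDerivAt.mul hby.hasFDerivAt)))).trans ?_
    simp [mul_add]
  rw [h1.fderiv_eq]
  have da := (ha.differentiableAt (by simp)).hasFDerivAt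
  have db := (hb.differentiableAt (by simp)).hasFDerivAt
  have dc := (hc.differentiableAt (by simp)).hasFDerivAt
  have da' := (differentiableAt_fderiv_apply ha w).hasFDerivAt
  have db' := (differentiableAt_fderiv_apply hb w).hasFDerivAt
  have dc' := (differentiableAt_fderiv_apply hc w).hasFDerivAt
  have h := (dc.mul ((da.mul db').add (db.mul da'))).add ((da.mul db).mul dc')
  refine (congrArg (fun L => L v) (HasFDerivAt.fderiv h)).trans ?_
  simp [ha0, hb0]
  ring

end SecondDerivative

variable {d : ℕ} {H : PhaseSpace d → ℝ}

/-! ### The displacement and the equivariance of the flow field. -/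

section Displacement

lemma contDiffAt_Psi (hH : ContDiff ℝ ∞ H) (g : GL (Fin d) ℝ) {x : ℝ × PhaseSpace d}
    (h : x ∈ flowDomain H) : ContDiffAt ℝ ∞ (Psi H g) x :=
  ((M g).contDiff.contDiffAt.comp x (contDiffAt_flow hH h)).sub contDiffAt_snd

lemma fderiv_Psi (hH : ContDiff ℝ ∞ H) (g : GL (Fin d) ℝ) {x : ℝ × PhaseSpace d}
    (h : x ∈ flowDomain H) (v : ℝ × PhaseSpace d) :
    fderiv ℝ (Psi H g) x v =
      v.1 • M g (hamField H (flow H x.1 x.2)) + (M g (monodromy H x.1 x.2 v.2) - v.2) := by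
  have h1 := ((M g).hasFDerivAt.comp x
    ((contDiffAt_flow hH h).differentiableAt (by simp)).hasFDerivAt).sub (hasFDerivAt_snd (𝕜 := ℝ))
  have h2 : fderiv ℝ (Psi H g) x = _ := h1.fderiv
  rw [h2]
  simp [fderiv_uncurry_flow hH h, add_sub_assoc]

lemma inner_gradient_M (hH : ContDiff ℝ ∞ H) {g : GL (Fin d) ℝ} (hg : ∀ z, H (M g z) = H z)
    (z a : PhaseSpace d) : inner ℝ (gradient H (M g z)) (M g a) = inner ℝ (gradient H z) a := by
  have h1 := (hH.differentiable (by simp) (M g z)).hasFDerivAt.comp z (M g).hasFDerivAt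
  have h2 : H ∘ M g = H := funext hg
  rw [h2] at h1
  rw [inner_gradient, inner_gradient, h1.fderiv]
  rfl

/-- A symplectic symmetry of `H` preserves its Hamiltonian field: after pairing with a test vector,
the claim is the chain rule for `H ∘ M g = H`. -/
lemma M_hamField (hH : ContDiff ℝ ∞ H) {g : GL (Fin d) ℝ} (hg : ∀ z, H (M g z) = H z)
    (z : PhaseSpace d) : M g (hamField H z) = hamField H (M g z) := by
  apply J_injective
  refine ext_inner_left ℝ fun a => ?_
  rw [← inner_M_inv_J, hamField, hamField, J_J, J_J, inner_neg_right, inner_neg_right,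
    real_inner_comm, ← inner_gradient_M hH hg, M_M_inv, real_inner_comm]

lemma fderiv_Psi_of_fixed (hH : ContDiff ℝ ∞ H) {g : GL (Fin d) ℝ} (hg : ∀ z, H (M g z) = H z)
    {t : ℝ} {z : PhaseSpace d} (h : (t, z) ∈ flowDomain H) (hfix : M g (flow H t z) = z)
    (v : ℝ × PhaseSpace d) :
    fderiv ℝ (Psi H g) (t, z) v =
      v.1 • J d (gradient H z) + (M g (monodromy H t z v.2) - v.2) := by
  rw [fderiv_Psi hH g h, M_hamField hH hg, hfix, hamField]

end Displacement

/-! ### Differential and Hessian of the real part φ₁. -/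

section RealPhase

variable (E : ℝ) (g : GL (Fin d) ℝ)

lemma contDiff_phaseIntegrand (hH : ContDiff ℝ ∞ H) : ContDiff ℝ ∞
    fun y : PhaseSpace d × PhaseSpace d => inner ℝ (y.1 - M g⁻¹ y.2) (J d (hamField H y.1)) := by
  have h1 := contDiff_hamField hH
  exact ContDiff.inner ℝ (by fun_prop) (by fun_prop)

lemma contDiffAt_phase₁ (hH : ContDiff ℝ ∞ H) {x : ℝ × PhaseSpace d} (h : x ∈ flowDomain H) :
    ContDiffAt ℝ ∞ (phase₁ H E g) x := by
  have h1 := contDiffAt_integral_flow hH (contDiff_phaseIntegrand g hH) h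
  have h2 : ContDiff ℝ ∞ fun x : ℝ × PhaseSpace d => inner ℝ (M g⁻¹ x.2) (J d x.2) :=
    ContDiff.inner ℝ (by fun_prop) (by fun_prop)
  have h3 : ContDiff ℝ ∞ fun x : ℝ × PhaseSpace d => (E - H x.2) * x.1 := by fun_prop
  exact (h3.contDiffAt.add (contDiffAt_const.mul h2.contDiffAt)).sub (contDiffAt_const.mul h1)

lemma fderiv_phase₁_time (hH : ContDiff ℝ ∞ H) {x : ℝ × PhaseSpace d} (h : x ∈ flowDomain H) :
    fderiv ℝ (phase₁ H E g) x (1, 0) = E - H x.2 +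
      (1 / 2) * inner ℝ (flow H x.1 x.2 - M g⁻¹ x.2) (gradient H (flow H x.1 x.2)) := by
  obtain ⟨t, z⟩ := x
  have hd := ((contDiffAt_phase₁ E g hH h).differentiableAt (by simp)).hasFDerivAt
  have h1 := HasFDerivAt.comp_hasDerivAt (f := fun s => (s, z)) t hd
    ((hasDerivAt_id t).prodMk (hasDerivAt_const t z))
  have hU : IsOpen {s : ℝ | (s, z) ∈ flowDomain H} :=
    (isOpen_flowDomain hH).preimage (f := fun s : ℝ => (s, z)) (by fun_prop)
  have hc : ContinuousOn (fun s => inner ℝ (flow H s z - M g⁻¹ z) (J d (hamField H (flow H s z))))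
      {s : ℝ | (s, z) ∈ flowDomain H} := fun s hs =>
    (ContinuousAt.comp (g := fun y : PhaseSpace d × PhaseSpace d =>
        inner ℝ (y.1 - M g⁻¹ y.2) (J d (hamField H y.1))) (f := fun s => (flow H s z, z))
      (contDiff_phaseIntegrand g hH).continuous.continuousAt
      ((hasDerivAt_flow hH hs).continuousAt.prodMk continuousAt_const)).continuousWithinAt
  have h2 : HasDerivAt (fun s => ∫ r in (0 : ℝ)..s,
      inner ℝ (flow H r z - M g⁻¹ z) (J d (hamField H (flow H r z))))
      (inner ℝ (flow H t z - M g⁻¹ z) (J d (hamField H (flow H t z)))) t :=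
    intervalIntegral.integral_hasDerivAt_right
      (hc.mono fun s hs => mem_flowDomain_of_mem_uIcc h hs).intervalIntegrable
      (hc.stronglyMeasurableAtFilter hU t h) (hc.continuousAt (hU.mem_nhds h))
  have h3 := (((hasDerivAt_id t).const_mul (E - H z)).add_const
    ((1 / 2) * inner ℝ (M g⁻¹ z) (J d z))).sub (h2.const_mul (1 / 2))
  rw [h1.unique h3, hamField, J_J, inner_neg_right]
  ring

/-- Both sides agree at time `0` and have the same time derivative. By symmetry of mixed
derivatives, that of the left side is the space derivative of the explicit `fderiv_phase₁_time`, so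
the integral is never differentiated in `z`. -/
lemma fderiv_phase₁_space (hH : ContDiff ℝ ∞ H) {t : ℝ} {z : PhaseSpace d}
    (h : (t, z) ∈ flowDomain H) (a : PhaseSpace d) :
    fderiv ℝ (phase₁ H E g) (t, z) (0, a) =
      (1 / 2) * inner ℝ a (J d (M g (flow H t z) - z)) -
        (1 / 2) * inner ℝ (flow H t z - M g⁻¹ z) (J d (monodromy H t z a)) := by
  have key := eq_of_hasDerivAt_zero (t := t) (f := fun s =>
    fderiv ℝ (phase₁ H E g) (s, z) (0, a) -
      ((1 / 2) * inner ℝ a (J d (M g (flow H s z) - z)) -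
        (1 / 2) * inner ℝ (flow H s z - M g⁻¹ z) (J d (monodromy H s z a)))) ?_
  · have h0 : fderiv ℝ (phase₁ H E g) (0, z) (0, a) =
        (1 / 2) * (inner ℝ (M g⁻¹ z) (J d a) + inner ℝ (M g⁻¹ a) (J d z)) := by
      have hd := ((contDiffAt_phase₁ E g hH (zero_mem_flowDomain z)).differentiableAt
        (by simp)).hasFDerivAt
      have h1 := HasFDerivAt.comp (f := fun w => ((0 : ℝ), w)) z hd
        (hasFDerivAt_prodMk_right (𝕜 := ℝ) (0 : ℝ) z)
      have h2 : (phase₁ H E g ∘ fun w => ((0 : ℝ), w)) =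
          fun w => (1 / 2) * inner ℝ (M g⁻¹ w) (J d w) := by
        funext w
        simp [phase₁]
      rw [h2] at h1
      have h3 := ((M g⁻¹).hasFDerivAt.inner ℝ (J d).hasFDerivAt (x := z)).const_mul (1 / 2)
      have h4 := congrArg (fun L => L a) (h1.unique h3)
      simpa using h4
    simp only [h0, flow_zero hH, monodromy_zero hH] at key
    rw [← sub_eq_zero, key, inner_M_inv_J g a z, map_sub, inner_sub_right, inner_sub_left]
    have := inner_J_left z a
    rw [real_inner_comm] at this
    rw [this]
    ring
  · intro s hs
    have hs' := mem_flowDomain_of_mem_uIcc h hs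
    have hsm := contDiffAt_phase₁ E g hH hs'
    have h1 := HasFDerivAt.comp_hasDerivAt (f := fun s => (s, z)) s
      (differentiableAt_fderiv_apply hsm (0, a)).hasFDerivAt
      ((hasDerivAt_id s).prodMk (hasDerivAt_const s z))
    have e1 : (fun y => fderiv ℝ (phase₁ H E g) y (1, 0)) =ᶠ[𝓝 (s, z)] fun y => E - H y.2 +
        (1 / 2) * inner ℝ (flow H y.1 y.2 - M g⁻¹ y.2) (gradient H (flow H y.1 y.2)) := by
      filter_upwards [(isOpen_flowDomain hH).mem_nhds hs'] with y hy
      exact fderiv_phase₁_time E g hH hy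
    have hΦ := ((contDiffAt_flow hH hs').differentiableAt (by simp)).hasFDerivAt
    have hsnd : HasFDerivAt (fun y : ℝ × PhaseSpace d => y.2)
      (ContinuousLinearMap.snd ℝ ℝ (PhaseSpace d)) (s, z) := hasFDerivAt_snd
    have e2 := HasFDerivAt.add
      (((hH.differentiable (by simp) z).hasFDerivAt.comp (s, z) hsnd).const_sub E)
      (((hΦ.sub ((M g⁻¹).hasFDerivAt.comp (s, z) hsnd)).inner ℝ
        (((contDiff_gradient hH).differentiable (by simp) (flow H s z)).hasFDerivAt.comp (s, z)
          hΦ)).const_mul (1 / 2))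
    have hval : fderiv ℝ (fun y => fderiv ℝ (phase₁ H E g) y (0, a)) (s, z) (1, 0) =
        -inner ℝ (gradient H z) a + (1 / 2) *
          (inner ℝ (flow H s z - M g⁻¹ z)
            (fderiv ℝ (gradient H) (flow H s z) (monodromy H s z a)) +
          inner ℝ (monodromy H s z a - M g⁻¹ a) (gradient H (flow H s z))) := by
      rw [fderiv_fderiv_apply_comm hsm, e1.fderiv_eq]
      refine (congrArg (fun L => L (0, a)) e2.fderiv).trans ?_
      simp [← monodromy_eq_fderiv hH hs']
    have h2 := (HasDerivAt.inner ℝ (hasDerivAt_const s a) ((J d).hasFDerivAt.comp_hasDerivAt s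
      (((M g).hasFDerivAt.comp_hasDerivAt s (hasDerivAt_flow hH hs')).sub_const z))).const_mul
        (1 / 2)
    have h3 := (HasDerivAt.inner ℝ ((hasDerivAt_flow hH hs').sub_const (M g⁻¹ z))
      ((J d).hasFDerivAt.comp_hasDerivAt s (hasDerivAt_monodromy hH hs' a))).const_mul (1 / 2)
    refine (h1.sub (h2.sub h3)).congr_deriv ?_
    rw [hval, fderiv_hamField hH, J_J, ← inner_M_inv_J, inner_neg_right]
    simp only [Function.comp_apply, hamField, J_J, inner_J_J, inner_neg_right, inner_zero_left,
      add_zero, inner_sub_left]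
    -- After the Hessian terms cancel, what remains is ⟨∇H(z_s), F a⟩ − ⟨∇H(z), a⟩, zero by
    -- differentiated energy conservation.
    rw [real_inner_comm (gradient H (flow H s z)) (monodromy H s z a),
      inner_gradient_flow_monodromy hH hs']
    ring

/-- The differential of the real part of the phase. -/
theorem fderiv_phase₁ (hH : ContDiff ℝ ∞ H) {x : ℝ × PhaseSpace d} (h : x ∈ flowDomain H)
    (v : ℝ × PhaseSpace d) :
    fderiv ℝ (phase₁ H E g) x v = v.1 * (E - H x.2) -
      (1 / 2) * inner ℝ (Psi H g x) (J d (fderiv ℝ (Psi H g) x v + (2 : ℝ) • v.2)) := by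
  obtain ⟨t, z⟩ := x
  have hv : v = v.1 • ((1 : ℝ), (0 : PhaseSpace d)) + (0, v.2) := by
    ext <;> simp
  have hΨ : flow H t z - M g⁻¹ z = M g⁻¹ (Psi H g (t, z)) := by
    simp [Psi, M_inv_M]
  conv_lhs => rw [hv]
  rw [map_add, map_smul, fderiv_phase₁_time E g hH h, fderiv_phase₁_space E g hH h,
    fderiv_Psi hH g h, hΨ, inner_M_inv_J]
  have h1 : inner ℝ (M g⁻¹ (Psi H g (t, z))) (gradient H (flow H t z)) =
      -inner ℝ (Psi H g (t, z)) (J d (M g (hamField H (flow H t z)))) := by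
    rw [← inner_M_inv_J, hamField, J_J, inner_neg_right, neg_neg]
  have h2 : inner ℝ v.2 (J d (M g (flow H t z) - z)) = -inner ℝ (Psi H g (t, z)) (J d v.2) := by
    have := inner_J_left (Psi H g (t, z)) v.2
    rw [real_inner_comm] at this
    exact this
  rw [h1, h2]
  simp only [map_add, map_sub, map_smul, inner_add_right, inner_sub_right, inner_smul_right,
    smul_eq_mul]
  ring

/-- The Hessian of the real part of the phase at a fixed point. -/
lemma fderiv_fderiv_phase₁ (hH : ContDiff ℝ ∞ H) {x : ℝ × PhaseSpace d} (h : x ∈ flowDomain H)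
    (h0 : Psi H g x = 0) (v w : ℝ × PhaseSpace d) :
    fderiv ℝ (fun y => fderiv ℝ (phase₁ H E g) y w) x v = -(w.1 * inner ℝ v.2 (gradient H x.2)) -
      (1 / 2) * inner ℝ (fderiv ℝ (Psi H g) x v) (J d (fderiv ℝ (Psi H g) x w + (2 : ℝ) • w.2)) := by
  have e1 : (fun y => fderiv ℝ (phase₁ H E g) y w) =ᶠ[𝓝 x] fun y => w.1 * (E - H y.2) -
      (1 / 2) * inner ℝ (Psi H g y) (J d (fderiv ℝ (Psi H g) y w + (2 : ℝ) • w.2)) := by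
    filter_upwards [(isOpen_flowDomain hH).mem_nhds h] with y hy
    exact fderiv_phase₁ E g hH hy w
  have hsnd : HasFDerivAt (fun y : ℝ × PhaseSpace d => y.2)
    (ContinuousLinearMap.snd ℝ ℝ (PhaseSpace d)) x := hasFDerivAt_snd
  have hΨ := contDiffAt_Psi hH g h
  have e2 := HasFDerivAt.sub
    ((((hH.differentiable (by simp) x.2).hasFDerivAt.comp x hsnd).const_sub E).const_mul w.1)
    (((hΨ.differentiableAt (by simp)).hasFDerivAt.inner ℝ ((J d).hasFDerivAt.comp x
      ((differentiableAt_fderiv_apply hΨ w).hasFDerivAt.add_const ((2 : ℝ) • w.2)))).const_mul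
        (1 / 2))
  rw [e1.fderiv_eq]
  refine (congrArg (fun L => L v) e2.fderiv).trans ?_
  rw [real_inner_comm]
  -- Since Ψ vanishes at `x`, the term containing the second derivative of Ψ drops out.
  simp [h0]

end RealPhase

end ReducedPhase

end

noncomputable section

namespace ReducedPhase

open Set Filter Topology

variable {d : ℕ} {H : PhaseSpace d → ℝ}

/-! ### The complex phase: critical set and kernel of the Hessian. -/

section ComplexPhase

variable (E : ℝ) (g : GL (Fin d) ℝ)

/-- The components of the displacement `M(g)Φ_t(z) - z`, as complex numbers. -/
def displacement (H : PhaseSpace d → ℝ) (g : GL (Fin d) ℝ) (i : Fin d ⊕ Fin d)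
    (x : ℝ × PhaseSpace d) : ℂ :=
  ((Psi H g x i : ℝ) : ℂ)

lemma contDiffAt_displacement (hH : ContDiff ℝ ∞ H) {x : ℝ × PhaseSpace d}
    (h : x ∈ flowDomain H) (i : Fin d ⊕ Fin d) : ContDiffAt ℝ ∞ (displacement H g i) x :=
  ContDiffAt.continuousLinearMap_comp (Complex.ofRealCLM ∘L EuclideanSpace.proj (𝕜 := ℝ) i)
    (contDiffAt_Psi hH g h)

lemma fderiv_displacement (hH : ContDiff ℝ ∞ H) {x : ℝ × PhaseSpace d}
    (h : x ∈ flowDomain H) (i : Fin d ⊕ Fin d) (v : ℝ × PhaseSpace d) :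
    fderiv ℝ (displacement H g i) x v = ((fderiv ℝ (Psi H g) x v i : ℝ) : ℂ) :=
  congrArg (fun L => L v) (HasFDerivAt.fderiv
    ((Complex.ofRealCLM ∘L EuclideanSpace.proj (𝕜 := ℝ) i).hasFDerivAt.comp x
      ((contDiffAt_Psi hH g h).differentiableAt (by simp)).hasFDerivAt))

/-- The coefficients of the quadratic form defining the imaginary part of the phase. -/
def quadCoeff (H : PhaseSpace d → ℝ) (g : GL (Fin d) ℝ)
    (p : (Fin d ⊕ Fin d) × (Fin d ⊕ Fin d)) (x : ℝ × PhaseSpace d) : ℂ :=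
  (1 / 4) * (1 - What H g x.1 x.2) p.1 p.2

lemma contDiffAt_quadCoeff (hH : ContDiff ℝ ∞ H) {x : ℝ × PhaseSpace d}
    (h : x ∈ flowDomain H) (p : (Fin d ⊕ Fin d) × (Fin d ⊕ Fin d)) :
    ContDiffAt ℝ ∞ (quadCoeff H g p) x :=
  contDiffAt_const.mul (contDiffAt_const.sub (contDiffAt_What hH g h p.1 p.2))

lemma sum_quadCoeff (x : ℝ × PhaseSpace d) (y : Fin d ⊕ Fin d → ℂ) :
    ∑ p, quadCoeff H g p x * (y p.2 * y p.1) =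
      (1 / 4) * (Matrix.mulVec (1 - What H g x.1 x.2) y ⬝ᵥ y) := by
  rw [Fintype.sum_prod_type, dotProduct, Finset.mul_sum]
  refine Finset.sum_congr rfl fun i _ => ?_
  rw [Matrix.mulVec, dotProduct, Finset.sum_mul, Finset.mul_sum]
  refine Finset.sum_congr rfl fun j _ => ?_
  rw [quadCoeff]
  ring

/-- Each summand has two factors vanishing where Ψ = 0, so the derivatives of the coefficients, and
hence of Ŵ, contribute neither to the gradient nor to the Hessian there. -/
lemma phase₂_eq_sum : phase₂ H g = fun x => ∑ p, quadCoeff H g p x *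
    (displacement H g p.2 x * displacement H g p.1 x) :=
  funext fun x => (sum_quadCoeff g x fun i => displacement H g i x).symm

lemma contDiffAt_phase₂ (hH : ContDiff ℝ ∞ H) {x : ℝ × PhaseSpace d} (h : x ∈ flowDomain H) :
    ContDiffAt ℝ ∞ (phase₂ H g) x := by
  rw [phase₂_eq_sum]
  exact ContDiffAt.sum fun p _ => (contDiffAt_quadCoeff g hH h p).mul
    ((contDiffAt_displacement g hH h p.2).mul (contDiffAt_displacement g hH h p.1))

lemma displacement_eq_zero {x : ℝ × PhaseSpace d} (h0 : Psi H g x = 0) (i : Fin d ⊕ Fin d) :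
    displacement H g i x = 0 := by
  simp [displacement, h0]

lemma fderiv_phase₂ (hH : ContDiff ℝ ∞ H) {x : ℝ × PhaseSpace d} (h : x ∈ flowDomain H)
    (h0 : Psi H g x = 0) : fderiv ℝ (phase₂ H g) x = 0 := by
  rw [phase₂_eq_sum, fderiv_fun_sum]
  · exact Finset.sum_eq_zero fun p _ => fderiv_mul_mul_of_eq_zero
      (contDiffAt_displacement g hH h p.2) (contDiffAt_displacement g hH h p.1)
      (contDiffAt_quadCoeff g hH h p) (displacement_eq_zero g h0 _) (displacement_eq_zero g h0 _)
  · exact fun p _ => ContDiffAt.differentiableAt ((contDiffAt_quadCoeff g hH h p).mul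
      ((contDiffAt_displacement g hH h p.2).mul (contDiffAt_displacement g hH h p.1))) (by simp)

lemma fderiv_fderiv_phase₂ (hH : ContDiff ℝ ∞ H) {x : ℝ × PhaseSpace d} (h : x ∈ flowDomain H)
    (h0 : Psi H g x = 0) (v w : ℝ × PhaseSpace d) :
    fderiv ℝ (fun y => fderiv ℝ (phase₂ H g) y w) x v = ∑ p, quadCoeff H g p x *
      (((fderiv ℝ (Psi H g) x v p.2 : ℝ) : ℂ) * ((fderiv ℝ (Psi H g) x w p.1 : ℝ) : ℂ) +
        ((fderiv ℝ (Psi H g) x v p.1 : ℝ) : ℂ) * ((fderiv ℝ (Psi H g) x w p.2 : ℝ) : ℂ)) := by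
  have hsm : ∀ p, ∀ y ∈ flowDomain H, ContDiffAt ℝ ∞ (fun y => quadCoeff H g p y *
      (displacement H g p.2 y * displacement H g p.1 y)) y := fun p y hy =>
    (contDiffAt_quadCoeff g hH hy p).mul
      ((contDiffAt_displacement g hH hy p.2).mul (contDiffAt_displacement g hH hy p.1))
  have e1 : (fun y => fderiv ℝ (phase₂ H g) y w) =ᶠ[𝓝 x] fun y => ∑ p, fderiv ℝ
      (fun y => quadCoeff H g p y * (displacement H g p.2 y * displacement H g p.1 y)) y w := by
    filter_upwards [(isOpen_flowDomain hH).mem_nhds h] with y hy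
    rw [phase₂_eq_sum, fderiv_fun_sum fun p _ => (hsm p y hy).differentiableAt (by simp),
      sum_apply]
  rw [e1.fderiv_eq, fderiv_fun_sum fun p _ => differentiableAt_fderiv_apply (hsm p x h) w,
    sum_apply]
  refine Finset.sum_congr rfl fun p _ => ?_
  rw [fderiv_fderiv_mul_mul_of_eq_zero (contDiffAt_displacement g hH h p.2)
    (contDiffAt_displacement g hH h p.1) (contDiffAt_quadCoeff g hH h p)
    (displacement_eq_zero g h0 _) (displacement_eq_zero g h0 _)]
  simp only [fderiv_displacement g hH h]

lemma contDiffAt_phase (hH : ContDiff ℝ ∞ H) {x : ℝ × PhaseSpace d} (h : x ∈ flowDomain H) :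
    ContDiffAt ℝ ∞ (phase H E g) x :=
  (ContDiffAt.continuousLinearMap_comp Complex.ofRealCLM (contDiffAt_phase₁ E g hH h)).add
    (contDiffAt_const.mul (contDiffAt_phase₂ g hH h))

lemma fderiv_phase (hH : ContDiff ℝ ∞ H) {x : ℝ × PhaseSpace d} (h : x ∈ flowDomain H)
    (v : ℝ × PhaseSpace d) : fderiv ℝ (phase H E g) x v =
      ((fderiv ℝ (phase₁ H E g) x v : ℝ) : ℂ) + Complex.I * fderiv ℝ (phase₂ H g) x v :=
  congrArg (fun L => L v) (HasFDerivAt.fderiv ((Complex.ofRealCLM.hasFDerivAt.comp x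
    ((contDiffAt_phase₁ E g hH h).differentiableAt (by simp)).hasFDerivAt).add
      (((contDiffAt_phase₂ g hH h).differentiableAt (by simp)).hasFDerivAt.const_mul Complex.I)))

lemma fderiv_fderiv_phase (hH : ContDiff ℝ ∞ H) {x : ℝ × PhaseSpace d} (h : x ∈ flowDomain H)
    (v w : ℝ × PhaseSpace d) : fderiv ℝ (fderiv ℝ (phase H E g)) x v w =
      ((fderiv ℝ (fun y => fderiv ℝ (phase₁ H E g) y w) x v : ℝ) : ℂ) +
        Complex.I * fderiv ℝ (fun y => fderiv ℝ (phase₂ H g) y w) x v := by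
  have e1 : (fun y => fderiv ℝ (phase H E g) y w) =ᶠ[𝓝 x] fun y =>
      ((fderiv ℝ (phase₁ H E g) y w : ℝ) : ℂ) + Complex.I * fderiv ℝ (phase₂ H g) y w := by
    filter_upwards [(isOpen_flowDomain hH).mem_nhds h] with y hy
    exact fderiv_phase E g hH hy w
  rw [fderiv_fderiv_apply (contDiffAt_phase E g hH h), e1.fderiv_eq]
  exact congrArg (fun L => L v) (HasFDerivAt.fderiv ((Complex.ofRealCLM.hasFDerivAt.comp x
    (differentiableAt_fderiv_apply (contDiffAt_phase₁ E g hH h) w).hasFDerivAt).add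
      ((differentiableAt_fderiv_apply
        (contDiffAt_phase₂ g hH h) w).hasFDerivAt.const_mul Complex.I)))

lemma im_phase (x : ℝ × PhaseSpace d) : (phase H E g x).im = (phase₂ H g x).re := by
  simp [phase]

lemma re_sum_quadCoeff_pos (hH : ContDiff ℝ ∞ H) {x : ℝ × PhaseSpace d} (h : x ∈ flowDomain H)
    {y : PhaseSpace d} (hy : y ≠ 0) :
    0 < (∑ p, quadCoeff H g p x * (((y p.2 : ℝ) : ℂ) * ((y p.1 : ℝ) : ℂ))).re := by
  have hy' : (fun i => y i) ≠ 0 := fun h0 => hy (by ext i; exact congrFun h0 i)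
  have h1 := re_What_form_pos hH g (t := x.1) (z := x.2) h hy'
  rw [sum_quadCoeff g x fun i => ((y i : ℝ) : ℂ)]
  have h2 : (1 / 4 : ℂ) = ((1 / 4 : ℝ) : ℂ) := by push_cast; rfl
  rw [h2, Complex.re_ofReal_mul]
  positivity

lemma im_phase_eq_zero_iff (hH : ContDiff ℝ ∞ H) {x : ℝ × PhaseSpace d} (h : x ∈ flowDomain H) :
    (phase H E g x).im = 0 ↔ Psi H g x = 0 := by
  rw [im_phase, phase₂_eq_sum]
  refine ⟨fun h1 => ?_, fun h0 => by simp [displacement_eq_zero g h0]⟩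
  by_contra h0
  exact (re_sum_quadCoeff_pos g hH h h0).ne' h1

theorem criticalSet_eq (hH : ContDiff ℝ ∞ H) : criticalSet H E g =
    {x | x ∈ flowDomain H ∧ H x.2 = E ∧ M g (flow H x.1 x.2) = x.2} := by
  ext x
  have hiff : M g (flow H x.1 x.2) = x.2 ↔ Psi H g x = 0 := sub_eq_zero.symm
  simp only [criticalSet, Set.mem_ofPred_eq, hiff]
  refine and_congr_right fun hx => ?_
  rw [im_phase_eq_zero_iff E g hH hx, and_comm]
  refine and_congr_left fun h0 => ?_
  -- Where Ψ = 0, only the explicit time dependence of φ₁ survives.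
  have hval : ∀ v, fderiv ℝ (phase H E g) x v = ((v.1 * (E - H x.2) : ℝ) : ℂ) := fun v => by
    rw [fderiv_phase E g hH hx, fderiv_phase₂ g hH hx h0, fderiv_phase₁ E g hH hx, h0]
    simp
  constructor
  · intro h1
    have h2 := hval (1, 0)
    rw [h1.fderiv] at h2
    have h3 : E - H x.2 = 0 := by simpa using Complex.ofReal_injective h2.symm
    linarith
  · intro hE
    have h1 := ((contDiffAt_phase E g hH hx).differentiableAt (by simp)).hasFDerivAt
    refine h1.congr_fderiv (ContinuousLinearMap.ext fun v => ?_)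
    rw [hval, hE]
    simp

/-- The real kernel of the Hessian at a critical point, through the differential of the
displacement. -/
lemma realKerHess_eq (hH : ContDiff ℝ ∞ H) {x : ℝ × PhaseSpace d} (h : x ∈ flowDomain H)
    (h0 : Psi H g x = 0) : realKerHess (phase H E g) x =
      {v | inner ℝ v.2 (gradient H x.2) = 0 ∧ fderiv ℝ (Psi H g) x v = 0} := by
  ext v
  simp only [realKerHess, Set.mem_ofPred_eq, fderiv_fderiv_phase E g hH h,
    fderiv_fderiv_phase₁ E g hH h h0, fderiv_fderiv_phase₂ g hH h h0]
  constructor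
  · intro hv
    have hΨ : fderiv ℝ (Psi H g) x v = 0 := by
      by_contra hne
      -- Testing against `w = v`: the Hessian of φ₁ is real, so the imaginary part is twice the
      -- positive definite form at dΨ v.
      have h1 := congrArg Complex.im (hv v)
      have h2 := re_sum_quadCoeff_pos g hH h hne
      simp only [Complex.add_im, Complex.ofReal_im, zero_add, Complex.I_mul_im,
        Complex.zero_im] at h1
      have h3 : ∑ p, quadCoeff H g p x *
          (((fderiv ℝ (Psi H g) x v p.2 : ℝ) : ℂ) * ((fderiv ℝ (Psi H g) x v p.1 : ℝ) : ℂ) +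
            ((fderiv ℝ (Psi H g) x v p.1 : ℝ) : ℂ) * ((fderiv ℝ (Psi H g) x v p.2 : ℝ) : ℂ)) =
          2 * ∑ p, quadCoeff H g p x *
          (((fderiv ℝ (Psi H g) x v p.2 : ℝ) : ℂ) * ((fderiv ℝ (Psi H g) x v p.1 : ℝ) : ℂ)) := by
        rw [Finset.mul_sum]
        exact Finset.sum_congr rfl fun p _ => by ring
      rw [h3, two_mul, Complex.add_re] at h1
      linarith
    refine ⟨?_, hΨ⟩
    -- Once dΨ v = 0, the Hessian is −w₁⟨α, ∇H⟩, and the time direction isolates the pairing.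
    have h4 := hv (1, 0)
    rw [hΨ] at h4
    simpa using h4
  · rintro ⟨hv, hΨ⟩ w
    rw [hΨ, hv]
    simp

end ComplexPhase

/-! ### Tangent space of a regular energy level. -/

section Tangent

/-- Tangent vectors to a regular level set, times an open interval. -/
lemma tangentVectors_prod_level (hH : ContDiff ℝ ∞ H) {E T t : ℝ} {z : PhaseSpace d}
    (ht : |t| < T) (hz : H z = E) (hne : gradient H z ≠ 0) :
    tangentVectors (Ioo (-T) T ×ˢ {w | H w = E}) (t, z) =
      {v : ℝ × PhaseSpace d | inner ℝ v.2 (gradient H z) = 0} := by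
  have htT : t ∈ Ioo (-T) T := abs_lt.1 ht
  ext ⟨τ, a⟩
  simp only [tangentVectors, Set.mem_ofPred_eq]
  constructor
  · rintro ⟨c, hc0, hcS, hc⟩
    have hc2 : HasDerivAt (fun s => (c s).2) a 0 :=
      (ContinuousLinearMap.snd ℝ ℝ (PhaseSpace d)).hasFDerivAt.comp_hasDerivAt 0 hc
    have hz' : (c 0).2 = z := by rw [hc0]
    have h1 := (hH.differentiable (by simp) (c 0).2).hasFDerivAt.comp_hasDerivAt 0 hc2
    have h2 : (fun s => H (c s).2) =ᶠ[𝓝 0] fun _ => E := hcS.mono fun s hs => hs.2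
    have h3 := (h1.congr_of_eventuallyEq h2.symm).unique (hasDerivAt_const 0 E)
    rw [real_inner_comm, inner_gradient, ← hz']
    exact h3
  · intro ha
    set n := gradient H z with hn
    -- The curve is sought as `z + s • a + ψ s • n`, correcting the line along the normal `n =
    -- ∇H(z)`. The implicit function theorem gives `ψ`, since the derivative of `f` in its second
    -- variable is |n|² ≠ 0.
    set f : ℝ × ℝ → ℝ := fun p => H (z + p.1 • a + p.2 • n) with hf
    have hfs : ContDiff ℝ ∞ f := by fun_prop
    have hfc : ContDiffAt ℝ ∞ f (0, 0) := hfs.contDiffAt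
    have hline : HasFDerivAt (fun p : ℝ × ℝ => z + p.1 • a + p.2 • n)
        ((ContinuousLinearMap.fst ℝ ℝ ℝ).smulRight a + (ContinuousLinearMap.snd ℝ ℝ ℝ).smulRight n)
        (0, 0) :=
      (((ContinuousLinearMap.fst ℝ ℝ ℝ).smulRight a).hasFDerivAt.const_add z).add
        ((ContinuousLinearMap.snd ℝ ℝ ℝ).smulRight n).hasFDerivAt
    have hzz : z + ((0, 0) : ℝ × ℝ).1 • a + ((0, 0) : ℝ × ℝ).2 • n = z := by simp
    have hHd : HasFDerivAt H (fderiv ℝ H z) (z + ((0, 0) : ℝ × ℝ).1 • a + ((0, 0) : ℝ × ℝ).2 • n) := by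
      rw [hzz]
      exact (hH.differentiable (by simp) z).hasFDerivAt
    have hfd : ∀ p, fderiv ℝ f (0, 0) p = p.2 * inner ℝ n n := by
      intro p
      have h1 : fderiv ℝ f (0, 0) = _ := (hHd.comp ((0, 0) : ℝ × ℝ) hline).fderiv
      rw [real_inner_comm, inner_gradient] at ha
      rw [h1, hn, inner_gradient]
      simp [ha]
    have hnn : inner ℝ n n ≠ 0 := inner_self_ne_zero.2 hne
    have hinv : (fderiv ℝ f (0, 0) ∘L .inr ℝ ℝ ℝ).IsInvertible := by
      refine ContinuousLinearMap.IsInvertible.of_inverse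
        (g := (inner ℝ n n)⁻¹ • ContinuousLinearMap.id ℝ ℝ) ?_ ?_
      · ext
        simpa [hfd] using inv_mul_cancel₀ hnn
      · ext
        simpa [hfd] using inv_mul_cancel₀ hnn
    set ψ := hfc.implicitFunction (by simp) hinv with hψ
    have hψ0 : ψ 0 = 0 := hfc.implicitFunction_apply_self (by simp) hinv
    have hψE : ∀ᶠ s in 𝓝 (0 : ℝ), f (s, ψ s) = E := by
      have h1 := hfc.eventually_apply_implicitFunction (by simp) hinv
      have h2 : f (0, 0) = E := by simp [hf, hz]
      rwa [h2] at h1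
    -- The derivative of `f` in its first variable is ⟨n, a⟩ = 0, so the correction is of second
    -- order and the velocity stays `a`.
    have hψd : HasDerivAt ψ 0 0 := by
      have h1 := (hfc.hasStrictFDerivAt_implicitFunction (by simp) hinv).hasFDerivAt.hasDerivAt
      refine h1.congr_deriv ?_
      simp [hfd]
    have hlin : HasDerivAt (fun s : ℝ => t + s * τ) τ 0 := by
      simpa using ((hasDerivAt_id (0 : ℝ)).mul_const τ).const_add t
    refine ⟨fun s => (t + s * τ, z + s • a + ψ s • n), by simp [hψ0], ?_, ?_⟩
    · have h1 : ∀ᶠ s in 𝓝 (0 : ℝ), t + s * τ ∈ Ioo (-T) T := by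
        refine hlin.continuousAt.eventually_mem (isOpen_Ioo.mem_nhds ?_)
        simpa using htT
      filter_upwards [h1, hψE] with s hs1 hs2 using ⟨hs1, hs2⟩
    · refine hlin.prodMk ?_
      have h1 := (((hasDerivAt_id (0 : ℝ)).smul_const a).const_add z).add (hψd.smul_const n)
      exact h1.congr_deriv (by simp)

end Tangent

end ReducedPhase

end

open ReducedPhase in
theorem mainTheorem6 (d : ℕ) (H : PhaseSpace d → ℝ) (hH : ContDiff ℝ ∞ H)
    (G : Subgroup (GL (Fin d) ℝ)) [Finite G]
    (hinv : ∀ g ∈ G, ∀ z, H (M g z) = H z)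
    (g : GL (Fin d) ℝ) (hg : g ∈ G) (E : ℝ) :
    -- the flow and the phase are smooth on the (open) domain of the flow, which is everything
    -- under the growth condition `|∇H| ≤ C (1 + |H|)`
    (IsOpen (flowDomain H) ∧
      ContDiffOn ℝ ∞ (fun x : ℝ × PhaseSpace d => flow H x.1 x.2) (flowDomain H) ∧
      ContDiffOn ℝ ∞ (phase H E g) (flowDomain H) ∧
      ((∃ C : ℝ, ∀ z, ‖gradient H z‖ ≤ C * (1 + |H z|)) → flowDomain H = Set.univ)) ∧
    -- the critical set
    criticalSet H E g =
      {x | x ∈ flowDomain H ∧ H x.2 = E ∧ M g (flow H x.1 x.2) = x.2} ∧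
    -- the real kernel of the Hessian at a critical point
    ∀ (t : ℝ) (z : PhaseSpace d), (t, z) ∈ criticalSet H E g →
      realKerHess (phase H E g) (t, z) =
        {v | inner ℝ v.2 (gradient H z) = 0 ∧
          v.1 • J d (gradient H z) + (M g (monodromy H t z v.2) - v.2) = 0} ∧
      ((∀ w, H w = E → gradient H w ≠ 0) → ∀ T : ℝ, |t| < T →
        kerDPsi H E T g (t, z) = realKerHess (phase H E g) (t, z)) := by
  refine ⟨⟨isOpen_flowDomain hH, fun x hx => (contDiffAt_flow hH hx).contDiffWithinAt,
    fun x hx => (contDiffAt_phase E g hH hx).contDiffWithinAt, flowDomain_eq_univ hH⟩,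
    criticalSet_eq E g hH, fun t z hcrit => ?_⟩
  rw [criticalSet_eq E g hH] at hcrit
  obtain ⟨hD, hE, hfix⟩ := hcrit
  have hker := realKerHess_eq E g hH hD (sub_eq_zero.2 hfix)
  refine ⟨?_, fun hreg T hT => ?_⟩
  · rw [hker]
    simp only [fderiv_Psi_of_fixed hH (hinv g hg) hD hfix]
  · rw [hker]
    ext v
    simp only [kerDPsi, tangentVectors_prod_level hH hT hE (hreg z hE), Set.mem_ofPred_eq]
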